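/- A *resource theory* is a symmetric strict monoidal category. A symmetric monoidal category is *compact closed* if every object $X$ has a dual $X^*$, with $\eta_X : I \to X\otimes X^*$ and $\varepsilon_X : X^*\otimes X\to I$ satisfying the snake equations. Let $\mathbb{A}$ be a resource theory with object monoid $(\mathbb{A}_0,\otimes,I)$. Let $\mathbb{A}^{\circ\bullet} = (\mathbb{A}_0\times\{\circ,\bullet\})^*$ be the free monoid of polarized objects, with concatenation written $\otimes$ and empty word $I$. The *free cornering* ${}^{\ulcorner}_{\llcorner}\mathbb{A}^{\urcorner}_{\lrcorner}$ is the free double category with one object, horizontal edge monoid $\mathbb{A}_0$ (top and bottom boundaries of cells) and vertical edge monoid $\mathbb{A}^{\circ\bullet}$ (left and right boundaries), generated by a cell $\ulcorner f\urcorner$ with top $A$, bottom $B$ and trivial sides for each arrow $f:A\to B$ of $\mathbb{A}$, and for each $A\in\mathbb{A}_0$ four corners, with boundaries (top, bottom, left, right) $(I,A,A^\circ,I)$, $(A,I,I,A^\circ)$, $(I,A,I,A^\bullet)$, $(A,I,A^\bullet,I)$; subject to the equations $\ulcorner 1_A\urcorner = 1_A$, $\ulcorner g\circ f\urcorner = \frac{\ulcorner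 f\urcorner}{\ulcorner g\urcorner}$, $\ulcorner f\otimes g\urcorner = \ulcorner f\urcorner\mid\ulcorner g\urcorner$, and the yanking equations: the two corners for $A^\circ$, and likewise the two corners for $A^\bullet$, compose horizontally to the vertical identity cell of $A$ and vertically to the horizontal identity cell of $A^\circ$, respectively $A^\bullet$. (Here $\alpha\mid\beta$ is horizontal and $\frac{\alpha}{\beta}$ vertical composition.) For $B\in\mathbb{A}_0$ and $X\in\mathbb{A}^{\circ\bullet}$ the *crossing cell* $\chi_{B,X}$, with top and bottom $B$ and left and right $X$, is built from the corners and the symmetry of $\mathbb{A}$: for $X=A^\circ$, $A$ enters on the left, is exchanged with $B$ and leaves on the right; for $X=A^\bullet$ it passes from right to left; $\chi_{B,X\otimes Y}=\frac{\chi_{B,X}}{\chi_{B,Y}}$ and $\chi_{B,I}=1_B$. If $\alpha$ has bottom $B$ and right boundary $Y$, and $\beta$ has top $A'$ and left boundary $X'$, let $\alpha\otimes\beta = \frac{\alpha\,\mid\,\chi_{A',Y}}{\chi_{B,X'}\,\mid\,\beta}$. Regard $\mathbb{A}^{\circ\bullet}$ as a reflexive graph with one vertex and trivial edge $I$, and let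 $\langle\mathbb{A}\rangle$ be the reflexive graph with vertices $\mathbb{A}_0$, edges the cells of the free cornering (from top to bottom boundary), and trivial edges the vertical identities. The category $\mathsf{S}(\mathbb{A})$ of *$\mathbb{A}$-situated transition systems* is as follows. An object is a reflexive graph $U$ with a homomorphism $\phi_U:U\to\mathbb{A}^{\circ\bullet}$. An arrow $(U,\phi_U)\to(V,\phi_V)$ is represented by a span $U\leftarrow R\to V$ of reflexive graphs with a homomorphism $\phi_R:R\to\langle\mathbb{A}\rangle$ such that, for each edge $t$ of $R$, the left and right boundaries of $\phi_R(t)$ are the values of $\phi_U$ and $\phi_V$ at the images of $t$. Two representatives $R,S$ define the same arrow if there are an isomorphism of spans $\alpha:R\to S$ and isomorphisms $\iota_a:\phi_R(a)\cong\phi_S(\alpha(a))$ in $\mathbb{A}$, for the vertices $a$ of $R$, with $\frac{\phi_R(t)}{\ulcorner\iota_b\urcorner}=\frac{\ulcorner\iota_a\urcorner}{\phi_S(\alpha(t))}$ for every edge $t:a\to b$ of $R$. Composition is by pullback of spans, with $\phi(t,t')=\phi_R(t)\mid\phi_S(t')$; the identity is the identity span with the horizontal identity cells. It is a monoidal category: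 the tensor product of objects is $U\times V$ with $(x,y)\mapsto\phi_U(x)\otimes\phi_V(y)$, that of arrows is the product of spans with $(t,t')\mapsto\phi_R(t)\otimes\phi_S(t')$, the unit is the one-vertex graph without nontrivial edges, and the associators and unitors are the canonical isomorphisms of graphs, taken as spans with one identity leg and labelled by horizontal identity cells. **Lemma 4.3.** If the resource theory $\mathbb{A}$ is compact closed, then the monoidal category $\mathsf{S}(\mathbb{A})$ of $\mathbb{A}$-situated transition systems is also compact closed: it admits a symmetry, and each of its objects has a dual. -/

import Mathlib

open CategoryTheory MonoidalCategory

universe p q v u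

set_option linter.unusedSectionVars false
set_option linter.unusedSimpArgs false
set_option linter.checkUnivs false

namespace Situated

/-- A monoidal category is strict if tensoring is associative and unital on the nose and the
coherence isomorphisms are identities. -/
class StrictMonoidal (C : Type u) [Category.{v} C] [MonoidalCategory C] : Prop where
  tensor_assoc (X Y Z : C) : (X ⊗ Y) ⊗ Z = X ⊗ (Y ⊗ Z)
  unit_tensor (X : C) : 𝟙_ C ⊗ X = X
  tensor_unit (X : C) : X ⊗ 𝟙_ C = X
  associator_eq (X Y Z : C) : α_ X Y Z = eqToIso (tensor_assoc X Y Z)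
  leftUnitor_eq (X : C) : λ_ X = eqToIso (unit_tensor X)
  rightUnitor_eq (X : C) : ρ_ X = eqToIso (tensor_unit X)

/-- Every object `X` has a dual `Y`, with unit `𝟙 ⟶ X ⊗ Y` and counit `Y ⊗ X ⟶ 𝟙` satisfying the
snake equations. -/
def HasDuals (C : Type u) [Category.{v} C] [MonoidalCategory C] : Prop :=
  ∀ X : C, ∃ Y : C, Nonempty (ExactPairing X Y)

/-! ### The free cornering -/

/-- The two directions in which a resource may cross a boundary: `circ` means from left to right,
`bullet` means from right to left. -/
inductive Polarity
  | circ
  | bullet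

/-- The free monoid of polarized objects; the product is concatenation, the unit is `[]`. -/
abbrev Exchange (C : Type u) : Type u := List (C × Polarity)

/-- Expressions for cells of the free cornering. Cells have a top and a bottom boundary, which are
objects of `C`, and a left and a right boundary, which are exchanges. An expression need not be
well formed, see `CellExpr.WF`. -/
inductive CellExpr (C : Type u) [Category.{v} C] : Type (max u v)
  /-- the cell of an arrow of `C` -/
  | arr {A B : C} (f : A ⟶ B)
  /-- vertical identity cell -/
  | vid (A : C)
  /-- horizontal identity cell -/
  | hid (X : Exchange C)
  /-- corner: `A` enters through the left boundary -/
  | circIn (A : C)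
  /-- corner: `A` leaves through the right boundary -/
  | circOut (A : C)
  /-- corner: `A` enters through the right boundary -/
  | bulletIn (A : C)
  /-- corner: `A` leaves through the left boundary -/
  | bulletOut (A : C)
  /-- horizontal composite, first argument on the left -/
  | hcomp (a b : CellExpr C)
  /-- vertical composite, first argument on top -/
  | vcomp (a b : CellExpr C)

namespace CellExpr

variable {C : Type u} [Category.{v} C] [MonoidalCategory C]

/-- top boundary -/
def top : CellExpr C → C
  | arr (A := A) _ => A
  | vid A => A
  | hid _ => 𝟙_ C
  | circIn _ => 𝟙_ C
  | circOut A => A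
  | bulletIn _ => 𝟙_ C
  | bulletOut A => A
  | hcomp a b => top a ⊗ top b
  | vcomp a _ => top a

/-- bottom boundary -/
def bot : CellExpr C → C
  | arr (B := B) _ => B
  | vid A => A
  | hid _ => 𝟙_ C
  | circIn A => A
  | circOut _ => 𝟙_ C
  | bulletIn A => A
  | bulletOut _ => 𝟙_ C
  | hcomp a b => bot a ⊗ bot b
  | vcomp _ b => bot b

/-- left boundary -/
def left : CellExpr C → Exchange C
  | arr _ => []
  | vid _ => []
  | hid X => X
  | circIn A => [(A, .circ)]
  | circOut _ => []
  | bulletIn _ => []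
  | bulletOut A => [(A, .bullet)]
  | hcomp a _ => left a
  | vcomp a b => left a ++ left b

/-- right boundary -/
def right : CellExpr C → Exchange C
  | arr _ => []
  | vid _ => []
  | hid X => X
  | circIn _ => []
  | circOut A => [(A, .circ)]
  | bulletIn A => [(A, .bullet)]
  | bulletOut _ => []
  | hcomp _ b => right b
  | vcomp a b => right a ++ right b

/-- An expression is well formed if in each composite in it the common boundaries agree. -/
def WF : CellExpr C → Prop
  | hcomp a b => WF a ∧ WF b ∧ right a = left b
  | vcomp a b => WF a ∧ WF b ∧ bot a = top b
  | _ => True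

/-- The equations of the free cornering: the yanking equations, functoriality of `arr`, the
equations of a double category, and closure under composition. -/
inductive Rel : CellExpr C → CellExpr C → Prop
  -- generators
  | arr_comp {A B D : C} (f : A ⟶ B) (g : B ⟶ D) : Rel (arr (f ≫ g)) (vcomp (arr f) (arr g))
  | arr_id (A : C) : Rel (arr (𝟙 A)) (vid A)
  | arr_tensor {A B A' B' : C} (f : A ⟶ B) (g : A' ⟶ B') :
      Rel (arr (f ⊗ₘ g)) (hcomp (arr f) (arr g))
  | circ_h (A : C) : Rel (hcomp (circOut A) (circIn A)) (vid A)
  | circ_v (A : C) : Rel (vcomp (circIn A) (circOut A)) (hid [(A, .circ)])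
  | bullet_h (A : C) : Rel (hcomp (bulletIn A) (bulletOut A)) (vid A)
  | bullet_v (A : C) : Rel (vcomp (bulletIn A) (bulletOut A)) (hid [(A, .bullet)])
  -- double category
  | h_assoc (a b c : CellExpr C) : Rel (hcomp (hcomp a b) c) (hcomp a (hcomp b c))
  | hid_h (a : CellExpr C) : Rel (hcomp (hid (left a)) a) a
  | h_hid (a : CellExpr C) : Rel (hcomp a (hid (right a))) a
  | v_assoc (a b c : CellExpr C) : Rel (vcomp (vcomp a b) c) (vcomp a (vcomp b c))
  | vid_v (a : CellExpr C) : Rel (vcomp (vid (top a)) a) a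
  | v_vid (a : CellExpr C) : Rel (vcomp a (vid (bot a))) a
  | hid_nil : Rel (hid []) (vid (𝟙_ C))
  | hid_append (X Y : Exchange C) : Rel (hid (X ++ Y)) (vcomp (hid X) (hid Y))
  | vid_tensor (A B : C) : Rel (vid (A ⊗ B)) (hcomp (vid A) (vid B))
  | interchange (a b c d : CellExpr C) (h₁ : right a = left b) (h₂ : right c = left d)
      (h₃ : bot a = top c) (h₄ : bot b = top d) :
      Rel (vcomp (hcomp a b) (hcomp c d)) (hcomp (vcomp a c) (vcomp b d))
  -- closure under composition
  | h_congr_left {a a' : CellExpr C} (b : CellExpr C) : Rel a a' → Rel (hcomp a b) (hcomp a' b)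
  | h_congr_right (a : CellExpr C) {b b' : CellExpr C} : Rel b b' → Rel (hcomp a b) (hcomp a b')
  | v_congr_left {a a' : CellExpr C} (b : CellExpr C) : Rel a a' → Rel (vcomp a b) (vcomp a' b)
  | v_congr_right (a : CellExpr C) {b b' : CellExpr C} : Rel b b' → Rel (vcomp a b) (vcomp a b')

variable [StrictMonoidal C]

theorem Rel.bdry {a b : CellExpr C} (h : Rel a b) :
    top a = top b ∧ bot a = bot b ∧ left a = left b ∧ right a = right b := by
  induction h <;>
    simp_all [top, bot, left, right, StrictMonoidal.tensor_assoc, StrictMonoidal.unit_tensor,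
      StrictMonoidal.tensor_unit]

theorem Rel.wf {a b : CellExpr C} (h : Rel a b) : WF a ↔ WF b := by
  induction h with
  | h_congr_left b h ih => have := h.bdry; simp_all [WF]
  | h_congr_right b h ih => have := h.bdry; simp_all [WF]
  | v_congr_left b h ih => have := h.bdry; simp_all [WF]
  | v_congr_right b h ih => have := h.bdry; simp_all [WF]
  | interchange a b c d h₁ h₂ h₃ h₄ => simp_all [WF, top, bot, left, right]; tauto
  | _ => simp [WF, top, bot, left, right, and_assoc, and_left_comm] <;> tauto

end CellExpr

/-- Cell expressions modulo the equations of the free cornering. -/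
def PreCell (C : Type u) [Category.{v} C] [MonoidalCategory C] : Type (max u v) :=
  Quot (CellExpr.Rel (C := C))

namespace PreCell

open CellExpr (Rel)

section basic

variable {C : Type u} [Category.{v} C] [MonoidalCategory C]

/-- the cell of an arrow -/
def arr {A B : C} (f : A ⟶ B) : PreCell C := Quot.mk _ (.arr f)
/-- vertical identity -/
def vid (A : C) : PreCell C := Quot.mk _ (.vid A)
/-- horizontal identity -/
def hid (X : Exchange C) : PreCell C := Quot.mk _ (.hid X)
/-- corner: `A` enters through the left boundary -/
def circIn (A : C) : PreCell C := Quot.mk _ (.circIn A)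
/-- corner: `A` leaves through the right boundary -/
def circOut (A : C) : PreCell C := Quot.mk _ (.circOut A)
/-- corner: `A` enters through the right boundary -/
def bulletIn (A : C) : PreCell C := Quot.mk _ (.bulletIn A)
/-- corner: `A` leaves through the left boundary -/
def bulletOut (A : C) : PreCell C := Quot.mk _ (.bulletOut A)

/-- horizontal composition -/
def hcomp (a b : PreCell C) : PreCell C :=
  Quot.map₂ CellExpr.hcomp (fun a _ _ h => Rel.h_congr_right a h)
    (fun _ _ b h => Rel.h_congr_left b h) a b

/-- vertical composition -/
def vcomp (a b : PreCell C) : PreCell C :=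
  Quot.map₂ CellExpr.vcomp (fun a _ _ h => Rel.v_congr_right a h)
    (fun _ _ b h => Rel.v_congr_left b h) a b

end basic

local infixl:65 " ∣ₕ " => PreCell.hcomp
local infixl:60 " ∕ᵥ " => PreCell.vcomp

variable {C : Type u} [Category.{v} C] [MonoidalCategory C] [StrictMonoidal C]

/-- top boundary -/
def top : PreCell C → C := Quot.lift CellExpr.top fun _ _ h => h.bdry.1
/-- bottom boundary -/
def bot : PreCell C → C := Quot.lift CellExpr.bot fun _ _ h => h.bdry.2.1
/-- left boundary -/
def left : PreCell C → Exchange C := Quot.lift CellExpr.left fun _ _ h => h.bdry.2.2.1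
/-- right boundary -/
def right : PreCell C → Exchange C := Quot.lift CellExpr.right fun _ _ h => h.bdry.2.2.2
/-- well-formedness of cell expressions does not depend on the representative -/
def WF : PreCell C → Prop := Quot.lift CellExpr.WF fun _ _ h => propext h.wf

attribute [local simp] StrictMonoidal.tensor_assoc StrictMonoidal.unit_tensor
  StrictMonoidal.tensor_unit

section bdry

@[simp] theorem top_arr {A B : C} (f : A ⟶ B) : (arr f).top = A := rfl
@[simp] theorem top_vid (A : C) : (vid A).top = A := rfl
@[simp] theorem top_hid (X : Exchange C) : (hid X).top = 𝟙_ C := rfl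
@[simp] theorem top_circIn (A : C) : (circIn A).top = 𝟙_ C := rfl
@[simp] theorem top_circOut (A : C) : (circOut A).top = A := rfl
@[simp] theorem top_bulletIn (A : C) : (bulletIn A).top = 𝟙_ C := rfl
@[simp] theorem top_bulletOut (A : C) : (bulletOut A).top = A := rfl
@[simp] theorem top_hcomp (a b : PreCell C) : (a ∣ₕ b).top = a.top ⊗ b.top := by
  induction a using Quot.ind; induction b using Quot.ind; rfl
@[simp] theorem top_vcomp (a b : PreCell C) : (a ∕ᵥ b).top = a.top := by
  induction a using Quot.ind; induction b using Quot.ind; rfl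

@[simp] theorem bot_arr {A B : C} (f : A ⟶ B) : (arr f).bot = B := rfl
@[simp] theorem bot_vid (A : C) : (vid A).bot = A := rfl
@[simp] theorem bot_hid (X : Exchange C) : (hid X).bot = 𝟙_ C := rfl
@[simp] theorem bot_circIn (A : C) : (circIn A).bot = A := rfl
@[simp] theorem bot_circOut (A : C) : (circOut A).bot = 𝟙_ C := rfl
@[simp] theorem bot_bulletIn (A : C) : (bulletIn A).bot = A := rfl
@[simp] theorem bot_bulletOut (A : C) : (bulletOut A).bot = 𝟙_ C := rfl
@[simp] theorem bot_hcomp (a b : PreCell C) : (a ∣ₕ b).bot = a.bot ⊗ b.bot := by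
  induction a using Quot.ind; induction b using Quot.ind; rfl
@[simp] theorem bot_vcomp (a b : PreCell C) : (a ∕ᵥ b).bot = b.bot := by
  induction a using Quot.ind; induction b using Quot.ind; rfl

@[simp] theorem left_arr {A B : C} (f : A ⟶ B) : (arr f).left = [] := rfl
@[simp] theorem left_vid (A : C) : (vid A).left = [] := rfl
@[simp] theorem left_hid (X : Exchange C) : (hid X).left = X := rfl
@[simp] theorem left_circIn (A : C) : (circIn A).left = [(A, .circ)] := rfl
@[simp] theorem left_circOut (A : C) : (circOut A).left = [] := rfl
@[simp] theorem left_bulletIn (A : C) : (bulletIn A).left = [] := rfl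
@[simp] theorem left_bulletOut (A : C) : (bulletOut A).left = [(A, .bullet)] := rfl
@[simp] theorem left_hcomp (a b : PreCell C) : (a ∣ₕ b).left = a.left := by
  induction a using Quot.ind; induction b using Quot.ind; rfl
@[simp] theorem left_vcomp (a b : PreCell C) : (a ∕ᵥ b).left = a.left ++ b.left := by
  induction a using Quot.ind; induction b using Quot.ind; rfl

@[simp] theorem right_arr {A B : C} (f : A ⟶ B) : (arr f).right = [] := rfl
@[simp] theorem right_vid (A : C) : (vid A).right = [] := rfl
@[simp] theorem right_hid (X : Exchange C) : (hid X).right = X := rfl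
@[simp] theorem right_circIn (A : C) : (circIn A).right = [] := rfl
@[simp] theorem right_circOut (A : C) : (circOut A).right = [(A, .circ)] := rfl
@[simp] theorem right_bulletIn (A : C) : (bulletIn A).right = [(A, .bullet)] := rfl
@[simp] theorem right_bulletOut (A : C) : (bulletOut A).right = [] := rfl
@[simp] theorem right_hcomp (a b : PreCell C) : (a ∣ₕ b).right = b.right := by
  induction a using Quot.ind; induction b using Quot.ind; rfl
@[simp] theorem right_vcomp (a b : PreCell C) : (a ∕ᵥ b).right = a.right ++ b.right := by
  induction a using Quot.ind; induction b using Quot.ind; rfl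

@[simp] theorem wf_arr {A B : C} (f : A ⟶ B) : (arr f).WF := trivial
@[simp] theorem wf_vid (A : C) : (vid A).WF := trivial
@[simp] theorem wf_hid (X : Exchange C) : (hid X).WF := trivial
@[simp] theorem wf_circIn (A : C) : (circIn A).WF := trivial
@[simp] theorem wf_circOut (A : C) : (circOut A).WF := trivial
@[simp] theorem wf_bulletIn (A : C) : (bulletIn A).WF := trivial
@[simp] theorem wf_bulletOut (A : C) : (bulletOut A).WF := trivial
@[simp] theorem wf_hcomp (a b : PreCell C) :
    (a ∣ₕ b).WF ↔ a.WF ∧ b.WF ∧ a.right = b.left := by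
  induction a using Quot.ind; induction b using Quot.ind; rfl
@[simp] theorem wf_vcomp (a b : PreCell C) :
    (a ∕ᵥ b).WF ↔ a.WF ∧ b.WF ∧ a.bot = b.top := by
  induction a using Quot.ind; induction b using Quot.ind; rfl

end bdry

section eqns

theorem arr_comp {A B D : C} (f : A ⟶ B) (g : B ⟶ D) : arr (f ≫ g) = (arr f ∕ᵥ arr g) :=
  Quot.sound (.arr_comp f g)
theorem arr_id (A : C) : arr (𝟙 A) = vid A := Quot.sound (.arr_id A)
theorem arr_tensor {A B A' B' : C} (f : A ⟶ B) (g : A' ⟶ B') :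
    arr (f ⊗ₘ g) = (arr f ∣ₕ arr g) := Quot.sound (.arr_tensor f g)
theorem arr_eqToHom {A B : C} (h : A = B) : arr (eqToHom h) = vid A := by
  subst h; exact arr_id A
theorem circ_h (A : C) : (circOut A ∣ₕ circIn A) = vid A := Quot.sound (.circ_h A)
theorem circ_v (A : C) : (circIn A ∕ᵥ circOut A) = hid [(A, .circ)] := Quot.sound (.circ_v A)
theorem bullet_h (A : C) : (bulletIn A ∣ₕ bulletOut A) = vid A := Quot.sound (.bullet_h A)
theorem bullet_v (A : C) : (bulletIn A ∕ᵥ bulletOut A) = hid [(A, .bullet)] :=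
  Quot.sound (.bullet_v A)
theorem h_assoc (a b c : PreCell C) : (a ∣ₕ b ∣ₕ c) = (a ∣ₕ (b ∣ₕ c)) := by
  induction a using Quot.ind; induction b using Quot.ind; induction c using Quot.ind
  exact Quot.sound (.h_assoc _ _ _)
theorem v_assoc (a b c : PreCell C) : (a ∕ᵥ b ∕ᵥ c) = (a ∕ᵥ (b ∕ᵥ c)) := by
  induction a using Quot.ind; induction b using Quot.ind; induction c using Quot.ind
  exact Quot.sound (.v_assoc _ _ _)
theorem hid_h (a : PreCell C) {X : Exchange C} (h : a.left = X) : (hid X ∣ₕ a) = a := by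
  subst h; induction a using Quot.ind; exact Quot.sound (.hid_h _)
theorem h_hid (a : PreCell C) {X : Exchange C} (h : a.right = X) : (a ∣ₕ hid X) = a := by
  subst h; induction a using Quot.ind; exact Quot.sound (.h_hid _)
theorem vid_v (a : PreCell C) {A : C} (h : a.top = A) : (vid A ∕ᵥ a) = a := by
  subst h; induction a using Quot.ind; exact Quot.sound (.vid_v _)
theorem v_vid (a : PreCell C) {A : C} (h : a.bot = A) : (a ∕ᵥ vid A) = a := by
  subst h; induction a using Quot.ind; exact Quot.sound (.v_vid _)
theorem hid_nil : hid [] = vid (𝟙_ C) := Quot.sound .hid_nil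
theorem hid_append (X Y : Exchange C) : hid (X ++ Y) = (hid X ∕ᵥ hid Y) :=
  Quot.sound (.hid_append X Y)
theorem vid_tensor (A B : C) : vid (A ⊗ B) = (vid A ∣ₕ vid B) := Quot.sound (.vid_tensor A B)
theorem interchange {a b c d : PreCell C} (h₁ : a.right = b.left) (h₂ : c.right = d.left)
    (h₃ : a.bot = c.top) (h₄ : b.bot = d.top) :
    ((a ∣ₕ b) ∕ᵥ (c ∣ₕ d)) = ((a ∕ᵥ c) ∣ₕ (b ∕ᵥ d)) := by
  induction a using Quot.ind; induction b using Quot.ind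
  induction c using Quot.ind; induction d using Quot.ind
  exact Quot.sound (.interchange _ _ _ _ h₁ h₂ h₃ h₄)

theorem vidI_h (a : PreCell C) (h : a.left = []) : (vid (𝟙_ C) ∣ₕ a) = a := by
  rw [← hid_nil, hid_h a h]
theorem h_vidI (a : PreCell C) (h : a.right = []) : (a ∣ₕ vid (𝟙_ C)) = a := by
  rw [← hid_nil, h_hid a h]

/-- induction principle for well-formed cells -/
theorem wf_induction {P : PreCell C → Prop}
    (arr : ∀ {A B : C} (f : A ⟶ B), P (arr f)) (vid : ∀ A, P (vid A)) (hid : ∀ X, P (hid X))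
    (circIn : ∀ A, P (circIn A)) (circOut : ∀ A, P (circOut A))
    (bulletIn : ∀ A, P (bulletIn A)) (bulletOut : ∀ A, P (bulletOut A))
    (hcomp : ∀ a b : PreCell C, a.WF → b.WF → a.right = b.left → P a → P b → P (a ∣ₕ b))
    (vcomp : ∀ a b : PreCell C, a.WF → b.WF → a.bot = b.top → P a → P b → P (a ∕ᵥ b))
    (a : PreCell C) (h : a.WF) : P a := by
  induction a using Quot.ind with
  | mk e =>
    induction e with
    | arr f => exact arr f
    | vid A => exact vid A
    | hid X => exact hid X
    | circIn A => exact circIn A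
    | circOut A => exact circOut A
    | bulletIn A => exact bulletIn A
    | bulletOut A => exact bulletOut A
    | hcomp a b iha ihb => exact hcomp (Quot.mk _ a) (Quot.mk _ b) h.1 h.2.1 h.2.2 (iha h.1) (ihb h.2.1)
    | vcomp a b iha ihb => exact vcomp (Quot.mk _ a) (Quot.mk _ b) h.1 h.2.1 h.2.2 (iha h.1) (ihb h.2.1)

theorem vidL_v {B : C} {a c : PreCell C} (h : a.bot = c.top) (ha : a.left = []) (hc : c.left = []) :
    (vid B ∣ₕ (a ∕ᵥ c)) = ((vid B ∣ₕ a) ∕ᵥ (vid B ∣ₕ c)) := by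
  rw [interchange (by simp [ha]) (by simp [hc]) (by simp) h, vid_v _ (by simp)]

theorem v_vidR {B : C} {a c : PreCell C} (h : a.bot = c.top) (ha : a.right = [])
    (hc : c.right = []) : ((a ∕ᵥ c) ∣ₕ vid B) = ((a ∣ₕ vid B) ∕ᵥ (c ∣ₕ vid B)) := by
  rw [interchange (by simp [ha]) (by simp [hc]) h (by simp), vid_v _ (by simp)]

/-- `a` before `b`, where `a` and `b` do not interact -/
theorem split_ab {a b : PreCell C} (ha : a.right = []) (hb : b.left = []) :
    (a ∣ₕ b) = ((a ∣ₕ vid b.top) ∕ᵥ (vid a.bot ∣ₕ b)) := by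
  rw [interchange (by simp [ha]) (by simp [hb]) (by simp) (by simp), vid_v _ (by simp),
    v_vid _ (by simp)]

/-- `b` before `a`, where `a` and `b` do not interact -/
theorem split_ba {a b : PreCell C} (ha : a.right = []) (hb : b.left = []) :
    (a ∣ₕ b) = ((vid a.top ∣ₕ b) ∕ᵥ (a ∣ₕ vid b.bot)) := by
  rw [interchange (by simp [hb]) (by simp [ha]) (by simp) (by simp), vid_v _ (by simp),
    v_vid _ (by simp)]

theorem arr_whiskerRight {A B : C} (f : A ⟶ B) (D : C) : arr (f ▷ D) = (arr f ∣ₕ vid D) := by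
  rw [← tensorHom_id, arr_tensor, arr_id]

theorem arr_whiskerLeft {A B : C} (f : A ⟶ B) (D : C) : arr (D ◁ f) = (vid D ∣ₕ arr f) := by
  rw [← id_tensorHom, arr_tensor, arr_id]

theorem arr_assoc (A B D : C) : arr (α_ A B D).hom = vid (A ⊗ (B ⊗ D)) := by
  rw [StrictMonoidal.associator_eq]; simp [arr_eqToHom]

theorem arr_assoc_inv (A B D : C) : arr (α_ A B D).inv = vid (A ⊗ (B ⊗ D)) := by
  rw [StrictMonoidal.associator_eq]; simp [arr_eqToHom]

theorem arr_lunit (A : C) : arr (λ_ A).hom = vid A := by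
  rw [StrictMonoidal.leftUnitor_eq]; simp [arr_eqToHom]

theorem arr_lunit_inv (A : C) : arr (λ_ A).inv = vid A := by
  rw [StrictMonoidal.leftUnitor_eq]; simp [arr_eqToHom]

theorem arr_runit (A : C) : arr (ρ_ A).hom = vid A := by
  rw [StrictMonoidal.rightUnitor_eq]; simp [arr_eqToHom]

theorem arr_runit_inv (A : C) : arr (ρ_ A).inv = vid A := by
  rw [StrictMonoidal.rightUnitor_eq]; simp [arr_eqToHom]

end eqns

/-! ### Crossing cells and the tensor product of cells -/

variable [SymmetricCategory C]

/-- The cell of the symmetry of `C`. -/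
def braid (A B : C) : PreCell C := arr (β_ A B).hom

/-- The crossing of `B` (from top to bottom) with one polarized object. -/
def crossOne (B : C) : C × Polarity → PreCell C
  | (A, .circ) => (circIn A ∣ₕ vid B) ∕ᵥ braid A B ∕ᵥ (vid B ∣ₕ circOut A)
  | (A, .bullet) => (vid B ∣ₕ bulletIn A) ∕ᵥ braid B A ∕ᵥ (bulletOut A ∣ₕ vid B)

/-- The crossing of `B` (from top to bottom) with an exchange. -/
def cross (B : C) : Exchange C → PreCell C
  | [] => vid B
  | x :: X => crossOne B x ∕ᵥ cross B X

/-- The tensor product of cells: first `a` happens, with the top boundary of `b` crossing its right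
boundary, then `b` happens, with the bottom boundary of `a` crossing its left boundary. -/
def tensor (a b : PreCell C) : PreCell C :=
  (a ∣ₕ cross b.top a.right) ∕ᵥ (cross a.bot b.left ∣ₕ b)

section cross

@[simp] theorem top_braid (A B : C) : (braid A B).top = A ⊗ B := rfl
@[simp] theorem bot_braid (A B : C) : (braid A B).bot = B ⊗ A := rfl
@[simp] theorem left_braid (A B : C) : (braid A B).left = [] := rfl
@[simp] theorem right_braid (A B : C) : (braid A B).right = [] := rfl
@[simp] theorem wf_braid (A B : C) : (braid A B).WF := trivial

@[simp] theorem bdry_crossOne (B : C) (x : C × Polarity) :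
    (crossOne B x).top = B ∧ (crossOne B x).bot = B ∧ (crossOne B x).left = [x] ∧
      (crossOne B x).right = [x] ∧ (crossOne B x).WF := by
  obtain ⟨A, _ | _⟩ := x <;> simp [crossOne]

@[simp] theorem bdry_cross (B : C) (X : Exchange C) :
    (cross B X).top = B ∧ (cross B X).bot = B ∧ (cross B X).left = X ∧
      (cross B X).right = X ∧ (cross B X).WF := by
  induction X <;> simp_all [cross, bdry_crossOne]

@[simp] theorem cross_nil (B : C) : cross B [] = vid B := rfl

@[simp] theorem top_cross (B : C) (X : Exchange C) : (cross B X).top = B := (bdry_cross B X).1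
@[simp] theorem bot_cross (B : C) (X : Exchange C) : (cross B X).bot = B := (bdry_cross B X).2.1
@[simp] theorem left_cross (B : C) (X : Exchange C) : (cross B X).left = X :=
  (bdry_cross B X).2.2.1
@[simp] theorem right_cross (B : C) (X : Exchange C) : (cross B X).right = X :=
  (bdry_cross B X).2.2.2.1
@[simp] theorem wf_cross (B : C) (X : Exchange C) : (cross B X).WF := (bdry_cross B X).2.2.2.2

theorem cross_append (B : C) (X Y : Exchange C) :
    cross B (X ++ Y) = (cross B X ∕ᵥ cross B Y) := by
  induction X with
  | nil => simp [cross, vid_v]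
  | cons x X ih => simp [cross, ih, v_assoc]

theorem braid_tensor_right (A B D : C) : braid A (B ⊗ D) =
    ((braid A B ∣ₕ vid D) ∕ᵥ (vid B ∣ₕ braid A D)) := by
  simp only [braid]
  rw [BraidedCategory.braiding_tensor_right_hom]
  simp only [arr_comp, arr_whiskerRight, arr_whiskerLeft, arr_assoc, arr_assoc_inv]
  rw [vid_v, vid_v, v_vid] <;> simp

theorem braid_tensor_left (A B D : C) : braid (A ⊗ B) D =
    ((vid A ∣ₕ braid B D) ∕ᵥ (braid A D ∣ₕ vid B)) := by
  simp only [braid]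
  rw [BraidedCategory.braiding_tensor_left_hom]
  simp only [arr_comp, arr_whiskerRight, arr_whiskerLeft, arr_assoc, arr_assoc_inv]
  rw [vid_v, vid_v, v_vid] <;> simp

theorem braid_unit_right (A : C) : braid A (𝟙_ C) = vid A := by
  rw [braid, braiding_tensorUnit_right]
  simp only [arr_comp, arr_runit, arr_lunit_inv]
  rw [vid_v _ (by simp)]

theorem braid_unit_left (A : C) : braid (𝟙_ C) A = vid A := by
  rw [braid, braiding_tensorUnit_left]
  simp only [arr_comp, arr_lunit, arr_runit_inv]
  rw [vid_v _ (by simp)]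

theorem braid_symm (A B : C) :
    (braid A B ∕ᵥ braid B A) = vid (A ⊗ B) := by
  simp only [braid]
  rw [← arr_comp, SymmetricCategory.symmetry, arr_id]

theorem braid_nat {A B A' B' : C} (f : A ⟶ B) (g : A' ⟶ B') :
    ((arr f ∣ₕ arr g) ∕ᵥ braid B B') = (braid A A' ∕ᵥ (arr g ∣ₕ arr f)) := by
  simp only [braid]
  rw [← arr_tensor, ← arr_tensor, ← arr_comp, ← arr_comp, BraidedCategory.braiding_naturality]

theorem crossOne_unit (x : C × Polarity) : crossOne (𝟙_ C) x = hid [x] := by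
  obtain ⟨A, _ | _⟩ := x
  · simp only [crossOne, braid_unit_right]
    rw [h_vidI _ (by simp), vidI_h _ (by simp), v_vid _ (by simp), circ_v]
  · simp only [crossOne, braid_unit_left]
    rw [h_vidI _ (by simp), vidI_h _ (by simp), v_vid _ (by simp), bullet_v]

theorem cross_unit (X : Exchange C) : cross (𝟙_ C) X = hid X := by
  induction X with
  | nil => simp [hid_nil]
  | cons x X ih => rw [cross, ih, crossOne_unit, ← hid_append]; rfl

theorem crossOne_tensor (B D : C) (x : C × Polarity) :
    crossOne (B ⊗ D) x = (crossOne B x ∣ₕ crossOne D x) := by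
  obtain ⟨A, _ | _⟩ := x
  · symm
    simp only [crossOne]
    rw [v_assoc (circIn A ∣ₕ vid D),
      ← v_vid (A := B) (circIn A ∣ₕ vid B ∕ᵥ braid A B ∕ᵥ vid B ∣ₕ circOut A) (by simp),
      ← interchange (by simp) (by simp) (by simp) (by simp),
      ← vid_v (A := D) (circIn A ∣ₕ vid D) (by simp),
      ← interchange (by simp) (by simp) (by simp) (by simp)]
    rw [h_assoc (vid B), ← h_assoc (circOut A), circ_h, v_vidR (by simp) (by simp) (by simp),
      vidL_v (by simp) (by simp) (by simp), ← vid_tensor, ← vid_tensor, v_vid _ (by simp),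
      braid_tensor_right, vid_tensor, h_assoc, ← vid_tensor, ← h_assoc, ← vid_tensor]
    simp only [v_assoc]
  · symm
    simp only [crossOne]
    rw [v_assoc (vid B ∣ₕ bulletIn A),
      ← vid_v (A := B) (vid B ∣ₕ bulletIn A ∕ᵥ _) (by simp),
      ← interchange (by simp) (by simp) (by simp) (by simp),
      ← v_vid (A := D) (bulletOut A ∣ₕ vid D) (by simp),
      ← interchange (by simp) (by simp) (by simp) (by simp)]
    rw [h_assoc (vid B), ← h_assoc (bulletIn A), bullet_h, v_vidR (by simp) (by simp) (by simp),
      vidL_v (by simp) (by simp) (by simp), ← vid_tensor, ← vid_tensor, vid_v _ (by simp),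
      braid_tensor_left, vid_tensor, h_assoc, ← vid_tensor, ← h_assoc, ← vid_tensor]
    simp only [v_assoc]

theorem cross_tensor (B D : C) (X : Exchange C) :
    cross (B ⊗ D) X = (cross B X ∣ₕ cross D X) := by
  induction X with
  | nil => simp [vid_tensor]
  | cons x X ih =>
    rw [cross, ih, crossOne_tensor, interchange (by simp) (by simp) (by simp) (by simp)]; rfl

/-- an arrow moves from right below to left above -/
theorem h_arr_comm {B D : C} (f : B ⟶ D) (b : PreCell C) (hb : b.left = []) (hb2 : b.bot = 𝟙_ C) :
    ((vid B ∣ₕ b) ∕ᵥ arr f) = ((arr f ∣ₕ vid b.top) ∕ᵥ (vid D ∣ₕ b)) := by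
  have h := split_ba (a := arr f) (b := b) (by simp) hb
  rw [hb2, h_vidI _ (by simp), split_ab (by simp) hb] at h
  simpa using h.symm

theorem arr_h_comm {B D : C} (f : B ⟶ D) (b : PreCell C) (hb : b.right = []) (hb2 : b.bot = 𝟙_ C) :
    ((b ∣ₕ vid B) ∕ᵥ arr f) = ((vid b.top ∣ₕ arr f) ∕ᵥ (b ∣ₕ vid D)) := by
  have h := split_ab (a := b) (b := arr f) hb (by simp)
  rw [hb2, vidI_h _ (by simp), split_ba hb (by simp)] at h
  simpa using h.symm

theorem arr_in_comm {B D : C} (f : B ⟶ D) (b : PreCell C) (hb : b.right = []) (hb2 : b.top = 𝟙_ C) :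
    ((b ∣ₕ vid B) ∕ᵥ (vid b.bot ∣ₕ arr f)) = (arr f ∕ᵥ (b ∣ₕ vid D)) := by
  have h := split_ab (a := b) (b := arr f) hb (by simp)
  rw [split_ba hb (by simp), hb2, vidI_h _ (by simp)] at h
  simpa using h.symm

theorem in_arr_comm {B D : C} (f : B ⟶ D) (b : PreCell C) (hb : b.left = []) (hb2 : b.top = 𝟙_ C) :
    ((vid B ∣ₕ b) ∕ᵥ (arr f ∣ₕ vid b.bot)) = (arr f ∕ᵥ (vid D ∣ₕ b)) := by
  have h := split_ba (a := arr f) (b := b) (by simp) hb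
  rw [split_ab (by simp) hb, hb2, h_vidI _ (by simp)] at h
  simpa using h.symm

theorem crossOne_nat {B D : C} (f : B ⟶ D) (x : C × Polarity) :
    (crossOne B x ∕ᵥ arr f) = (arr f ∕ᵥ crossOne D x) := by
  obtain ⟨A, _ | _⟩ := x
  · have h := arr_in_comm f (circIn A) (by simp) (by simp)
    simp only [bot_circIn] at h
    simp only [crossOne, ← v_assoc, ← h]
    rw [v_assoc _ _ (arr f), h_arr_comm f (circOut A) (by simp) (by simp), v_assoc (circIn A ∣ₕ _) _ (braid A D)]
    simp only [top_circOut, ← arr_id]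
    rw [braid_nat]
    simp only [v_assoc]
  · have h := in_arr_comm f (bulletIn A) (by simp) (by simp)
    simp only [bot_bulletIn] at h
    simp only [crossOne, ← v_assoc, ← h]
    rw [v_assoc _ _ (arr f), arr_h_comm f (bulletOut A) (by simp) (by simp),
      v_assoc (_ ∣ₕ bulletIn A) _ (braid D A)]
    simp only [top_bulletOut, ← arr_id]
    rw [braid_nat]
    simp only [v_assoc]

theorem cross_nat {B D : C} (f : B ⟶ D) (X : Exchange C) :
    (cross B X ∕ᵥ arr f) = (arr f ∕ᵥ cross D X) := by
  induction X with
  | nil => rw [cross_nil, cross_nil, vid_v _ (by simp), v_vid _ (by simp)]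
  | cons x X ih => rw [cross, v_assoc, ih, ← v_assoc, crossOne_nat, v_assoc, ← cross]

/-- Crossing cells slide past arbitrary cells. -/
theorem slide (D : C) (a : PreCell C) (h : a.WF) :
    ((cross D a.left ∣ₕ a) ∕ᵥ braid D a.bot) =
      (braid D a.top ∕ᵥ (a ∣ₕ cross D a.right)) := by
  refine wf_induction (P := fun a => ((cross D a.left ∣ₕ a) ∕ᵥ braid D a.bot) =
      (braid D a.top ∕ᵥ (a ∣ₕ cross D a.right))) ?_ ?_ ?_ ?_ ?_ ?_ ?_ ?_ ?_ a h
  · intro A B f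
    simp only [left_arr, right_arr, cross_nil, bot_arr, top_arr, ← arr_id, braid_nat]
  · intro A
    simp only [left_vid, right_vid, cross_nil, bot_vid, top_vid]
    rw [← arr_id, ← arr_id, braid_nat]
  · intro X
    simp only [left_hid, right_hid, bot_hid, top_hid, braid_unit_right]
    rw [h_hid _ (by simp), hid_h _ (by simp), v_vid _ (by simp), vid_v _ (by simp)]
  · intro A
    simp only [left_circIn, right_circIn, bot_circIn, top_circIn, braid_unit_right, cross_nil,
      cross]
    rw [v_vid _ (by simp), crossOne, ← vid_v (A := 𝟙_ C) (circIn A) (by simp),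
      ← interchange (by simp) (by simp) (by simp) (by simp), vid_v (circIn A) (by simp),
      h_vidI _ (by simp), h_assoc, circ_h, ← vid_tensor, v_vid _ (by simp), v_assoc, braid_symm,
      v_vid _ (by simp), vid_v _ (by simp)]
  · intro A
    simp only [left_circOut, right_circOut, bot_circOut, top_circOut, braid_unit_right, cross_nil,
      cross]
    rw [v_vid _ (by simp), v_vid _ (by simp), crossOne, v_assoc,
      ← v_vid (A := 𝟙_ C) (circOut A) (by simp),
      ← interchange (by simp) (by simp) (by simp) (by simp), v_vid (circOut A) (by simp),
      vidI_h _ (by simp), ← h_assoc, circ_h, ← vid_tensor, vid_v _ (by simp), ← v_assoc, braid_symm,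
      vid_v _ (by simp)]
  · intro A
    simp only [left_bulletIn, right_bulletIn, bot_bulletIn, top_bulletIn, braid_unit_right,
      cross_nil, cross]
    rw [v_vid _ (by simp), vid_v _ (by simp), crossOne,
      ← vid_v (A := 𝟙_ C) (bulletIn A) (by simp),
      ← interchange (by simp) (by simp) (by simp) (by simp), vid_v (bulletIn A) (by simp),
      vidI_h _ (by simp), ← h_assoc, bullet_h, ← vid_tensor, v_vid _ (by simp)]
  · intro A
    simp only [left_bulletOut, right_bulletOut, bot_bulletOut, top_bulletOut, braid_unit_right,
      cross_nil, cross]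
    rw [v_vid _ (by simp), v_vid _ (by simp), crossOne, v_assoc,
      ← v_vid (A := 𝟙_ C) (bulletOut A) (by simp),
      ← interchange (by simp) (by simp) (by simp) (by simp), v_vid (bulletOut A) (by simp),
      h_vidI _ (by simp), h_assoc, bullet_h, ← vid_tensor, vid_v _ (by simp)]
  · intro a b ha hb hab iha ihb
    simp only [left_hcomp, right_hcomp, bot_hcomp, top_hcomp, braid_tensor_right]
    rw [← v_assoc, ← h_assoc,
      interchange (by simp [hab]) (by simp) (by simp) (by simp), iha, v_vid _ (by simp),
      ← vid_v (A := b.top) b (by simp), ← interchange (by simp) (by simp [hab]) (by simp) (by simp),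
      vid_v b (by simp), v_assoc, h_assoc, hab,
      interchange (by simp [hab]) (by simp) (by simp) (by simp), ihb, v_vid _ (by simp),
      ← vid_v (A := a.top) a (by simp), ← interchange (by simp) (by simp [hab]) (by simp) (by simp),
      vid_v a (by simp), h_assoc, v_assoc]
  · intro a b ha hb hab iha ihb
    simp only [left_vcomp, right_vcomp, bot_vcomp, top_vcomp, cross_append]
    rw [← interchange (by simp) (by simp) (by simp) hab, v_assoc, ihb, ← v_assoc, ← hab, iha,
      v_assoc, interchange (by simp) (by simp) hab (by simp)]

end cross

theorem slide_inv (D : C) (a : PreCell C) (h : a.WF) :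
    (braid a.top D ∕ᵥ (cross D a.left ∣ₕ a)) = ((a ∣ₕ cross D a.right) ∕ᵥ braid a.bot D) := by
  have h₁ := slide D a h
  calc (braid a.top D ∕ᵥ (cross D a.left ∣ₕ a))
      = (braid a.top D ∕ᵥ ((cross D a.left ∣ₕ a) ∕ᵥ (braid D a.bot ∕ᵥ braid a.bot D))) := by
        rw [braid_symm, v_vid _ (by simp)]
    _ = ((braid a.top D ∕ᵥ braid D a.top) ∕ᵥ ((a ∣ₕ cross D a.right) ∕ᵥ braid a.bot D)) := by
        rw [← v_assoc (cross D a.left ∣ₕ a), h₁]; simp only [v_assoc]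
    _ = _ := by rw [braid_symm, vid_v _ (by simp)]

section tensor

@[simp] theorem top_tensor (a b : PreCell C) : (tensor a b).top = a.top ⊗ b.top := by simp [tensor]
@[simp] theorem bot_tensor (a b : PreCell C) : (tensor a b).bot = a.bot ⊗ b.bot := by simp [tensor]
@[simp] theorem left_tensor (a b : PreCell C) : (tensor a b).left = a.left ++ b.left := by
  simp [tensor]
@[simp] theorem right_tensor (a b : PreCell C) : (tensor a b).right = a.right ++ b.right := by
  simp [tensor]
@[simp] theorem wf_tensor (a b : PreCell C) : (tensor a b).WF ↔ a.WF ∧ b.WF := by simp [tensor]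

theorem vid_tensor_vid (A B : C) : tensor (vid A) (vid B) = vid (A ⊗ B) := by
  simp only [tensor, left_vid, right_vid, top_vid, bot_vid, cross_nil, ← vid_tensor]
  rw [vid_v _ (by simp)]

theorem hid_tensor_hid (X Y : Exchange C) : tensor (hid X) (hid Y) = hid (X ++ Y) := by
  simp only [tensor, left_hid, right_hid, top_hid, bot_hid, cross_unit]
  rw [hid_h _ (by simp), hid_h _ (by simp), hid_append]

theorem unit_tensor (a : PreCell C) : tensor (vid (𝟙_ C)) a = a := by
  simp only [tensor, right_vid, bot_vid, cross_nil, cross_unit]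
  rw [hid_h _ rfl, vidI_h _ (by simp), vid_v _ rfl]

theorem tensor_unit (a : PreCell C) : tensor a (vid (𝟙_ C)) = a := by
  simp only [tensor, left_vid, top_vid, cross_nil, cross_unit]
  rw [h_hid _ rfl, h_vidI _ (by simp), v_vid _ rfl]

theorem tensor_assoc (a b c : PreCell C) :
    tensor (tensor a b) c = tensor a (tensor b c) := by
  simp only [tensor, right_vcomp, right_hcomp, bot_vcomp, bot_hcomp, top_vcomp, top_hcomp,
    left_vcomp, left_hcomp, right_cross, left_cross, top_cross, bot_cross, cross_append,
    cross_tensor]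
  rw [← interchange (by simp) (by simp) (by simp) (by simp),
    ← interchange (a := cross a.bot b.left) (by simp) (by simp) (by simp) (by simp)]
  simp only [h_assoc, v_assoc]

theorem tensor_conj {A₁ A₂ A₁' A₂' B₁ B₂ B₁' B₂' : C} {a a' b b' : PreCell C}
    (f₁ : A₁ ⟶ A₁') (f₂ : A₂ ⟶ A₂') (g₁ : B₁ ⟶ B₁') (g₂ : B₂ ⟶ B₂')
    (ha₁ : a.top = A₁) (ha₂ : a.bot = A₂) (ha₁' : a'.top = A₁') (ha₂' : a'.bot = A₂')
    (hb₁ : b.top = B₁) (hb₂ : b.bot = B₂) (hb₁' : b'.top = B₁') (hb₂' : b'.bot = B₂')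
    (ha : (a ∕ᵥ arr f₂) = (arr f₁ ∕ᵥ a')) (hb : (b ∕ᵥ arr g₂) = (arr g₁ ∕ᵥ b')) :
    (tensor a b ∕ᵥ arr (f₂ ⊗ₘ g₂)) = (arr (f₁ ⊗ₘ g₁) ∕ᵥ tensor a' b') := by
  subst ha₁ ha₂ ha₁' ha₂' hb₁ hb₂ hb₁' hb₂'
  have hl : b.left = b'.left := by simpa using congrArg left hb
  have hr : a.right = a'.right := by simpa using congrArg right ha
  simp only [tensor, arr_tensor]
  rw [v_assoc, interchange (by simp) (by simp) (by simp) (by simp), hb, cross_nat,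
    ← interchange (by simp) (by simp [hl]) (by simp) (by simp), ← v_assoc,
    interchange (by simp) (by simp) (by simp) (by simp), ha, cross_nat,
    ← interchange (by simp) (by simp [hr]) (by simp) (by simp), v_assoc, hl, hr]

theorem tensor_interchange (a b c d : PreCell C) (hb : b.WF) (hc : c.WF)
    (h₁ : a.right = c.left) (h₂ : b.right = d.left) :
    (tensor (a ∣ₕ c) (b ∣ₕ d) ∕ᵥ (vid a.bot ∣ₕ (braid c.bot b.bot ∣ₕ vid d.bot))) =
      ((vid a.top ∣ₕ (braid c.top b.top ∣ₕ vid d.top)) ∕ᵥ (tensor a b ∣ₕ tensor c d)) := by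
  have e₁ := slide_inv b.top c hc
  have e₂ := slide c.bot b hb
  have L : tensor (a ∣ₕ c) (b ∣ₕ d) = ((a ∣ₕ ((c ∣ₕ cross b.top c.right) ∣ₕ cross d.top c.right)) ∕ᵥ
      (cross a.bot b.left ∣ₕ ((cross c.bot b.left ∣ₕ b) ∣ₕ d))) := by
    simp only [tensor, right_hcomp, left_hcomp, top_hcomp, bot_hcomp, cross_tensor, h_assoc]
  have R : (tensor a b ∣ₕ tensor c d) =
      ((a ∣ₕ ((cross b.top c.left ∣ₕ c) ∣ₕ cross d.top c.right)) ∕ᵥ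
      (cross a.bot b.left ∣ₕ ((b ∣ₕ cross c.bot b.right) ∣ₕ d))) := by
    rw [tensor, tensor, ← interchange (by simp [h₁]) (by simp [h₂]) (by simp) (by simp), h₁, h₂]
    simp only [h_assoc]
  have M : ((a ∣ₕ ((c ∣ₕ cross b.top c.right) ∣ₕ cross d.top c.right)) ∕ᵥ
        (vid a.bot ∣ₕ (braid c.bot b.top ∣ₕ vid d.top))) =
      ((vid a.top ∣ₕ (braid c.top b.top ∣ₕ vid d.top)) ∕ᵥ
        (a ∣ₕ ((cross b.top c.left ∣ₕ c) ∣ₕ cross d.top c.right))) := by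
    rw [interchange (by simp [h₁]) (by simp) (by simp) (by simp),
      interchange (by simp) (by simp) (by simp) (by simp),
      interchange (by simp) (by simp [h₁]) (by simp) (by simp),
      interchange (by simp) (by simp) (by simp) (by simp), e₁]
    simp [v_vid, vid_v]
  have N : ((cross a.bot b.left ∣ₕ ((cross c.bot b.left ∣ₕ b) ∣ₕ d)) ∕ᵥ
        (vid a.bot ∣ₕ (braid c.bot b.bot ∣ₕ vid d.bot))) =
      ((vid a.bot ∣ₕ (braid c.bot b.top ∣ₕ vid d.top)) ∕ᵥ
        (cross a.bot b.left ∣ₕ ((b ∣ₕ cross c.bot b.right) ∣ₕ d))) := by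
    rw [interchange (by simp) (by simp) (by simp) (by simp),
      interchange (by simp [h₂]) (by simp) (by simp) (by simp),
      interchange (by simp) (by simp) (by simp) (by simp),
      interchange (by simp) (by simp [h₂]) (by simp) (by simp), e₂]
    simp [v_vid, vid_v]
  rw [L, R, v_assoc, N, ← v_assoc, M, v_assoc]

end tensor

end PreCell

/-- A cell of the free cornering of `C`: a well-formed cell expression modulo the equations. The
equations only relate well-formed expressions to well-formed ones, with the same boundaries. -/
def Cell (C : Type u) [Category.{v} C] [MonoidalCategory C] [StrictMonoidal C] :
    Type (max u v) :=
  {a : PreCell C // a.WF}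

/-! ### Reflexive graphs -/

/-- Reflexive graphs: vertices `V`, edges `E` with source and target, and trivial edges. -/
structure RGraph : Type (max (p + 1) (q + 1)) where
  V : Type p
  E : Type q
  src : E → V
  tgt : E → V
  triv : V → E
  src_triv (a : V) : src (triv a) = a
  tgt_triv (a : V) : tgt (triv a) = a

namespace RGraph

attribute [simp] src_triv tgt_triv

universe p₁ q₁ p₂ q₂ p₃ q₃

/-- Homomorphisms of reflexive graphs. -/
@[ext]
structure Hom (G : RGraph.{p₁, q₁}) (H : RGraph.{p₂, q₂}) : Type (max p₁ q₁ p₂ q₂) where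
  onV : G.V → H.V
  onE : G.E → H.E
  src_onE (t : G.E) : H.src (onE t) = onV (G.src t)
  tgt_onE (t : G.E) : H.tgt (onE t) = onV (G.tgt t)
  onE_triv (a : G.V) : onE (G.triv a) = H.triv (onV a)

attribute [simp] Hom.src_onE Hom.tgt_onE Hom.onE_triv

/-- identity homomorphism -/
@[simps]
def Hom.id (G : RGraph.{p₁, q₁}) : Hom G G where
  onV a := a
  onE t := t
  src_onE _ := rfl
  tgt_onE _ := rfl
  onE_triv _ := rfl

/-- composition of homomorphisms, in diagrammatic order -/
@[simps]
def Hom.comp {G : RGraph.{p₁, q₁}} {H : RGraph.{p₂, q₂}} {K : RGraph.{p₃, q₃}} (f : Hom G H)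
    (g : Hom H K) : Hom G K where
  onV a := g.onV (f.onV a)
  onE t := g.onE (f.onE t)
  src_onE _ := by simp
  tgt_onE _ := by simp
  onE_triv _ := by simp

/-- The category of reflexive graphs. -/
instance : Category RGraph.{p, q} where
  Hom := Hom
  id := Hom.id
  comp := Hom.comp

@[simp] theorem id_onV (G : RGraph.{p, q}) (a : G.V) : Hom.onV (𝟙 G) a = a := rfl
@[simp] theorem id_onE (G : RGraph.{p, q}) (t : G.E) : Hom.onE (𝟙 G) t = t := rfl
@[simp] theorem comp_onV {G H K : RGraph.{p, q}} (f : G ⟶ H) (g : H ⟶ K) (a : G.V) :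
    Hom.onV (f ≫ g) a = Hom.onV g (Hom.onV f a) := rfl
@[simp] theorem comp_onE {G H K : RGraph.{p, q}} (f : G ⟶ H) (g : H ⟶ K) (t : G.E) :
    Hom.onE (f ≫ g) t = Hom.onE g (Hom.onE f t) := rfl

@[simp] theorem hom_inv_onV {G H : RGraph.{p, q}} (e : G ≅ H) (a : G.V) :
    e.inv.onV (e.hom.onV a) = a := by rw [← comp_onV, e.hom_inv_id]; rfl
@[simp] theorem hom_inv_onE {G H : RGraph.{p, q}} (e : G ≅ H) (a : G.E) :
    e.inv.onE (e.hom.onE a) = a := by rw [← comp_onE, e.hom_inv_id]; rfl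
@[simp] theorem inv_hom_onV {G H : RGraph.{p, q}} (e : G ≅ H) (a : H.V) :
    e.hom.onV (e.inv.onV a) = a := by rw [← comp_onV, e.inv_hom_id]; rfl
@[simp] theorem inv_hom_onE {G H : RGraph.{p, q}} (e : G ≅ H) (a : H.E) :
    e.hom.onE (e.inv.onE a) = a := by rw [← comp_onE, e.inv_hom_id]; rfl

/-- An isomorphism from a homomorphism and an inverse on vertices and edges. -/
@[simps! hom]
def isoMk {G H : RGraph.{p, q}} (f : Hom G H) (gV : H.V → G.V) (gE : H.E → G.E)
    (h₁ : ∀ a, gV (f.onV a) = a) (h₂ : ∀ a, f.onV (gV a) = a)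
    (h₃ : ∀ a, gE (f.onE a) = a) (h₄ : ∀ a, f.onE (gE a) = a) : G ≅ H where
  hom := f
  inv :=
    { onV := gV
      onE := gE
      src_onE := fun t => by rw [← h₁ (G.src _), ← f.src_onE, h₄]
      tgt_onE := fun t => by rw [← h₁ (G.tgt _), ← f.tgt_onE, h₄]
      onE_triv := fun a => by rw [← h₃ (G.triv _), f.onE_triv, h₂] }
  hom_inv_id := Hom.ext (funext h₁) (funext h₃)
  inv_hom_id := Hom.ext (funext h₂) (funext h₄)

/-- The product of reflexive graphs. -/
def prod (G H : RGraph.{p, q}) : RGraph.{p, q} where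
  V := G.V × H.V
  E := G.E × H.E
  src t := (G.src t.1, H.src t.2)
  tgt t := (G.tgt t.1, H.tgt t.2)
  triv a := (G.triv a.1, H.triv a.2)
  src_triv a := by simp
  tgt_triv a := by simp

/-- The product of homomorphisms. -/
def Hom.prod {G H G' H' : RGraph.{p, q}} (f : Hom G G') (g : Hom H H') :
    Hom (G.prod H) (G'.prod H') where
  onV a := (f.onV a.1, g.onV a.2)
  onE t := (f.onE t.1, g.onE t.2)
  src_onE _ := Prod.ext (f.src_onE _) (g.src_onE _)
  tgt_onE _ := Prod.ext (f.tgt_onE _) (g.tgt_onE _)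
  onE_triv _ := Prod.ext (f.onE_triv _) (g.onE_triv _)

/-- The graph with one vertex and no nontrivial edges. -/
@[simps]
def unit : RGraph.{p, q} where
  V := PUnit
  E := PUnit
  src _ := ⟨⟩
  tgt _ := ⟨⟩
  triv _ := ⟨⟩
  src_triv _ := rfl
  tgt_triv _ := rfl

/-- The pullback of homomorphisms with the same target. -/
def pullback {G H K : RGraph.{p, q}} (f : Hom G K) (g : Hom H K) : RGraph.{p, q} where
  V := {a : G.V × H.V // f.onV a.1 = g.onV a.2}
  E := {t : G.E × H.E // f.onE t.1 = g.onE t.2}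
  src t := ⟨(G.src t.1.1, H.src t.1.2), by simp [← Hom.src_onE, t.2]⟩
  tgt t := ⟨(G.tgt t.1.1, H.tgt t.1.2), by simp [← Hom.tgt_onE, t.2]⟩
  triv a := ⟨(G.triv a.1.1, H.triv a.1.2), by simp [a.2]⟩
  src_triv a := by simp
  tgt_triv a := by simp

/-- The exchanges as a reflexive graph with one vertex, whose trivial edge is the unit. -/
@[simps]
def exchange (C : Type u) : RGraph.{u, u} where
  V := PUnit
  E := Exchange C
  src _ := ⟨⟩
  tgt _ := ⟨⟩
  triv _ := []
  src_triv _ := rfl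
  tgt_triv _ := rfl

section cells

variable (C : Type u) [Category.{v} C] [MonoidalCategory C] [StrictMonoidal C]

/-- The reflexive graph whose vertices are the objects of `C` and whose edges are the cells of the
free cornering, from their top to their bottom boundary. Trivial edges are vertical identities. -/
@[simps]
def cells : RGraph.{u, max u v} where
  V := C
  E := Cell C
  src a := a.1.top
  tgt a := a.1.bot
  triv A := ⟨PreCell.vid A, PreCell.wf_vid A⟩
  src_triv _ := rfl
  tgt_triv _ := rfl

/-- The left boundary of cells. -/
@[simps]
def cellsLeft : Hom (cells C) (exchange C) where
  onV _ := ⟨⟩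
  onE a := a.1.left
  src_onE _ := rfl
  tgt_onE _ := rfl
  onE_triv _ := rfl

/-- The right boundary of cells. -/
@[simps]
def cellsRight : Hom (cells C) (exchange C) where
  onV _ := ⟨⟩
  onE a := a.1.right
  src_onE _ := rfl
  tgt_onE _ := rfl
  onE_triv _ := rfl

end cells

end RGraph

/-! ### Situated transition systems -/

/-- A `C`-situated boundary: a reflexive graph with a homomorphism to the graph of exchanges.
These are the objects of the category of situated transition systems. -/
structure SituatedBoundary (C : Type u) : Type (max (p + 1) (q + 1) u) where
  graph : RGraph.{p, q}
  sit : RGraph.Hom graph (RGraph.exchange C)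

section systems

variable {C : Type u} [Category.{v} C] [MonoidalCategory C] [StrictMonoidal C]

/-- A `C`-situated transition system from `U` to `V`: a span of reflexive graphs with a
homomorphism from the apex to the graph of cells that is coherent with the situations of the
boundaries. -/
structure SituatedSystem (U V : SituatedBoundary.{p, q} C) :
    Type (max (p + 1) (q + 1) u v) where
  apex : RGraph.{p, q}
  legL : RGraph.Hom apex U.graph
  legR : RGraph.Hom apex V.graph
  sit : RGraph.Hom apex (RGraph.cells C)
  coh_left : sit.comp (RGraph.cellsLeft C) = legL.comp U.sit
  coh_right : sit.comp (RGraph.cellsRight C) = legR.comp V.sit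

namespace SituatedSystem

open PreCell RGraph

local infixl:65 " ∣ₕ " => PreCell.hcomp
local infixl:60 " ∕ᵥ " => PreCell.vcomp

variable {U V W U' V' W' : SituatedBoundary.{p, q} C}

/-- The object of `C` assigned to a state. -/
def obj (R : SituatedSystem U V) (a : R.apex.V) : C := R.sit.onV a

/-- The cell assigned to a transition. -/
def cell (R : SituatedSystem U V) (t : R.apex.E) : PreCell C := (R.sit.onE t).1

@[simp] theorem wf_cell (R : SituatedSystem U V) (t : R.apex.E) : (R.cell t).WF :=
  (R.sit.onE t).2
@[simp] theorem left_cell (R : SituatedSystem U V) (t : R.apex.E) :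
    (R.cell t).left = U.sit.onE (R.legL.onE t) := congrFun (congrArg Hom.onE R.coh_left) t
@[simp] theorem right_cell (R : SituatedSystem U V) (t : R.apex.E) :
    (R.cell t).right = V.sit.onE (R.legR.onE t) := congrFun (congrArg Hom.onE R.coh_right) t
@[simp] theorem top_cell (R : SituatedSystem U V) (t : R.apex.E) :
    (R.cell t).top = R.obj (R.apex.src t) := R.sit.src_onE t
@[simp] theorem bot_cell (R : SituatedSystem U V) (t : R.apex.E) :
    (R.cell t).bot = R.obj (R.apex.tgt t) := R.sit.tgt_onE t
@[simp] theorem cell_triv (R : SituatedSystem U V) (a : R.apex.V) :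
    R.cell (R.apex.triv a) = vid (R.obj a) := congrArg Subtype.val (R.sit.onE_triv a)

/-- Two situated transition systems are equivalent if there are an isomorphism `α` of the spans
and a natural isomorphism `ι` from the situation of `R` to `α` followed by the situation of `S`. -/
def Equivalent (R S : SituatedSystem U V) : Prop :=
  ∃ α : R.apex ≅ S.apex,
    Hom.comp α.hom S.legL = R.legL ∧ Hom.comp α.hom S.legR = R.legR ∧
    ∃ ι : ∀ a : R.apex.V, R.obj a ≅ S.obj (α.hom.onV a),
      ∀ t : R.apex.E, (R.cell t ∕ᵥ arr (ι (R.apex.tgt t)).hom) =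
        (arr (ι (R.apex.src t)).hom ∕ᵥ S.cell (α.hom.onE t))

theorem nat_of_vid {a b f g : PreCell C} {A B : C} (hf : f = vid A) (hg : g = vid B)
    (hA : b.top = A) (hB : a.bot = B) (h : a = b) : (a ∕ᵥ g) = (f ∕ᵥ b) := by
  rw [hf, hg, v_vid a hB, vid_v b hA, h]

theorem Equivalent.refl (R : SituatedSystem U V) : Equivalent R R := by
  refine ⟨Iso.refl _, rfl, rfl, fun a => Iso.refl _, fun t => ?_⟩
  change (_ ∕ᵥ arr (𝟙 _)) = (arr (𝟙 _) ∕ᵥ R.cell t)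
  rw [arr_id, arr_id, v_vid _ (by simp), vid_v _ (by simp)]

theorem Equivalent.symm {R S : SituatedSystem U V} (h : Equivalent R S) : Equivalent S R := by
  obtain ⟨α, h₁, h₂, ι, h⟩ := h
  have key : ∀ {A B A' B' : C} (a b : PreCell C) (f : A ≅ A') (g : B ≅ B'),
      a.top = A → a.bot = B → b.top = A' → b.bot = B' →
      (a ∕ᵥ arr g.hom) = (arr f.hom ∕ᵥ b) → (b ∕ᵥ arr g.inv) = (arr f.inv ∕ᵥ a) := by
    intro A B A' B' a b f g h₁ h₂ h₃ h₄ h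
    rw [← vid_v b h₃, ← arr_id, ← f.inv_hom_id, arr_comp, v_assoc (arr f.inv), ← h, v_assoc,
      v_assoc, ← arr_comp, g.hom_inv_id, arr_id, v_vid _ h₂]
  have e : ∀ a : S.apex.V, S.obj a = S.obj (α.hom.onV (α.inv.onV a)) := by simp
  have hι : ∀ a a', a = a' → arr (ι a).inv = arr (ι a').inv := by rintro a _ rfl; rfl
  refine ⟨α.symm, ?_, ?_, fun a => eqToIso (e a) ≪≫ (ι (α.inv.onV a)).symm, fun t => ?_⟩
  · rw [← h₁]; ext <;> simp
  · rw [← h₂]; ext <;> simp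
  · have := key _ _ _ _ (by simp) (by simp) (by simp) (by simp) (h (α.inv.onE t))
    simp only [Iso.trans_hom, eqToIso.hom, Iso.symm_hom, arr_comp, arr_eqToHom]
    rw [← v_assoc, v_vid _ (by simp), vid_v _ (by simp)]
    simp only [inv_hom_onE] at this
    rw [hι _ _ (α.inv.tgt_onE t).symm, hι _ _ (α.inv.src_onE t).symm, this]

theorem Equivalent.trans {R S T : SituatedSystem U V} (h : Equivalent R S)
    (h' : Equivalent S T) : Equivalent R T := by
  obtain ⟨α, h₁, h₂, ι, h⟩ := h
  obtain ⟨β, h₁', h₂', κ, h'⟩ := h'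
  have hκ : ∀ a a', a = a' → arr (κ a).hom = arr (κ a').hom := by rintro a _ rfl; rfl
  refine ⟨α ≪≫ β, ?_, ?_, fun a => ι a ≪≫ κ (α.hom.onV a), fun t => ?_⟩
  · rw [← h₁, ← h₁']; rfl
  · rw [← h₂, ← h₂']; rfl
  · have e := h t
    have e' := h' (α.hom.onE t)
    rw [hκ _ _ (α.hom.tgt_onE t), hκ _ _ (α.hom.src_onE t)] at e'
    change (R.cell t ∕ᵥ arr ((ι (R.apex.tgt t)).hom ≫ (κ (α.hom.onV (R.apex.tgt t))).hom)) =
      (arr ((ι (R.apex.src t)).hom ≫ (κ (α.hom.onV (R.apex.src t))).hom) ∕ᵥ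
        T.cell (β.hom.onE (α.hom.onE t)))
    rw [arr_comp, arr_comp, ← v_assoc, e, v_assoc, e', v_assoc]

variable (U V) in
/-- Equivalence of situated transition systems as a setoid. -/
def setoid : Setoid (SituatedSystem U V) where
  r := Equivalent
  iseqv := ⟨Equivalent.refl, Equivalent.symm, Equivalent.trans⟩

/-- The situated transition system given by a homomorphism of graphs that preserves the
situations: its left leg is the identity, its situation consists of horizontal identities. -/
def ofHom (f : Hom U.graph V.graph) (h : f.comp V.sit = U.sit) : SituatedSystem U V where
  apex := U.graph
  legL := Hom.id U.graph
  legR := f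
  sit :=
    { onV := fun _ => 𝟙_ C
      onE := fun t => ⟨hid (U.sit.onE t), wf_hid _⟩
      src_onE := fun _ => rfl
      tgt_onE := fun _ => rfl
      onE_triv := fun a => Subtype.ext ((congrArg hid (U.sit.onE_triv a)).trans hid_nil) }
  coh_left := rfl
  coh_right := by rw [h]; rfl

/-- The identity system. -/
def id (U : SituatedBoundary.{p, q} C) : SituatedSystem U U :=
  ofHom (Hom.id U.graph) rfl

theorem top_comp_cell (R : SituatedSystem U V) (S : SituatedSystem U' V') (t : R.apex.E)
    (t' : S.apex.E) :
    (R.cell t ∣ₕ S.cell t').top = R.obj (R.apex.src t) ⊗ S.obj (S.apex.src t') := by simp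

theorem bot_comp_cell (R : SituatedSystem U V) (S : SituatedSystem U' V') (t : R.apex.E)
    (t' : S.apex.E) :
    (R.cell t ∣ₕ S.cell t').bot = R.obj (R.apex.tgt t) ⊗ S.obj (S.apex.tgt t') := by simp

/-- Composition of situated transition systems: the pullback of the spans, with horizontal
composites of cells as situation. -/
def comp (R : SituatedSystem U V) (S : SituatedSystem V W) : SituatedSystem U W where
  apex := RGraph.pullback R.legR S.legL
  legL :=
    { onV := fun a => R.legL.onV a.1.1
      onE := fun t => R.legL.onE t.1.1
      src_onE := fun _ => R.legL.src_onE _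
      tgt_onE := fun _ => R.legL.tgt_onE _
      onE_triv := fun _ => R.legL.onE_triv _ }
  legR :=
    { onV := fun a => S.legR.onV a.1.2
      onE := fun t => S.legR.onE t.1.2
      src_onE := fun _ => S.legR.src_onE _
      tgt_onE := fun _ => S.legR.tgt_onE _
      onE_triv := fun _ => S.legR.onE_triv _ }
  sit :=
    { onV := fun a => (R.obj a.1.1 ⊗ S.obj a.1.2 : C)
      onE := fun t => ⟨R.cell t.1.1 ∣ₕ S.cell t.1.2, (wf_hcomp _ _).2 ⟨wf_cell _ _, wf_cell _ _,
        by rw [right_cell, left_cell]; exact congrArg _ t.2⟩⟩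
      src_onE := fun t => top_comp_cell R S t.1.1 t.1.2
      tgt_onE := fun t => bot_comp_cell R S t.1.1 t.1.2
      onE_triv := fun a => Subtype.ext ((congrArg₂ _ (cell_triv _ _) (cell_triv _ _)).trans
        (vid_tensor _ _).symm) }
  coh_left := Hom.ext rfl (funext fun t => (left_hcomp _ _).trans (left_cell _ _))
  coh_right := Hom.ext rfl (funext fun t => (right_hcomp _ _).trans (right_cell _ _))

theorem comp_congr {R R' : SituatedSystem U V} {S S' : SituatedSystem V W} (h : Equivalent R R')
    (h' : Equivalent S S') : Equivalent (comp R S) (comp R' S') := by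
  obtain ⟨α, h₁, h₂, ι, h⟩ := h
  obtain ⟨β, h₁', h₂', κ, h'⟩ := h'
  have l₁ : ∀ a, S'.legL.onV (β.hom.onV a) = S.legL.onV a := fun a => by rw [← h₁']; rfl
  have l₂ : ∀ a, S'.legL.onE (β.hom.onE a) = S.legL.onE a := fun a => by rw [← h₁']; rfl
  have r₁ : ∀ a, R'.legR.onV (α.hom.onV a) = R.legR.onV a := fun a => by rw [← h₂]; rfl
  have r₂ : ∀ a, R'.legR.onE (α.hom.onE a) = R.legR.onE a := fun a => by rw [← h₂]; rfl
  refine ⟨RGraph.isoMk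
    { onV := fun a => ⟨(α.hom.onV a.1.1, β.hom.onV a.1.2), by simp [l₁, r₁, a.2]⟩
      onE := fun a => ⟨(α.hom.onE a.1.1, β.hom.onE a.1.2), by simp [l₂, r₂, a.2]⟩
      src_onE := fun t => Subtype.ext (Prod.ext (α.hom.src_onE _) (β.hom.src_onE _))
      tgt_onE := fun t => Subtype.ext (Prod.ext (α.hom.tgt_onE _) (β.hom.tgt_onE _))
      onE_triv := fun t => Subtype.ext (Prod.ext (α.hom.onE_triv _) (β.hom.onE_triv _)) }
    (fun a => ⟨(α.inv.onV a.1.1, β.inv.onV a.1.2), by simp [← l₁, ← r₁, a.2]⟩)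
    (fun a => ⟨(α.inv.onE a.1.1, β.inv.onE a.1.2), by simp [← l₂, ← r₂, a.2]⟩)
    (fun a => Subtype.ext (Prod.ext (hom_inv_onV α _) (hom_inv_onV β _)))
    (fun a => Subtype.ext (Prod.ext (inv_hom_onV α _) (inv_hom_onV β _)))
    (fun a => Subtype.ext (Prod.ext (hom_inv_onE α _) (hom_inv_onE β _)))
    (fun a => Subtype.ext (Prod.ext (inv_hom_onE α _) (inv_hom_onE β _))),
    ?_, ?_, fun a => MonoidalCategory.tensorIso (ι a.1.1) (κ a.1.2), fun t => ?_⟩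
  · exact Hom.ext (funext fun a => congrFun (congrArg Hom.onV h₁) a.1.1)
      (funext fun a => congrFun (congrArg Hom.onE h₁) a.1.1)
  · exact Hom.ext (funext fun a => congrFun (congrArg Hom.onV h₂') a.1.2)
      (funext fun a => congrFun (congrArg Hom.onE h₂') a.1.2)
  · have e₁ : (R.cell t.1.1).right = (S.cell t.1.2).left := by
      rw [right_cell, left_cell]; exact congrArg _ t.2
    have e₂ : (R'.cell (α.hom.onE t.1.1)).right = (S'.cell (β.hom.onE t.1.2)).left := by
      rw [right_cell, left_cell, l₂, r₂]; exact congrArg _ t.2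
    change ((R.cell t.1.1 ∣ₕ S.cell t.1.2) ∕ᵥ arr ((ι (R.apex.tgt t.1.1)).hom ⊗ₘ (κ (S.apex.tgt t.1.2)).hom))
      = (arr ((ι (R.apex.src t.1.1)).hom ⊗ₘ (κ (S.apex.src t.1.2)).hom) ∕ᵥ
        (R'.cell (α.hom.onE t.1.1) ∣ₕ S'.cell (β.hom.onE t.1.2)))
    rw [arr_tensor, arr_tensor, interchange e₁ (by simp) (by simp) (by simp), h, h',
      interchange (by simp) e₂ (by simp) (by simp)]

theorem comp_assoc {X : SituatedBoundary.{p, q} C} (R : SituatedSystem U V)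
    (S : SituatedSystem V W) (T : SituatedSystem W X) :
    Equivalent (comp (comp R S) T) (comp R (comp S T)) := by
  refine ⟨RGraph.isoMk
    { onV := fun a => ⟨(a.1.1.1.1, ⟨(a.1.1.1.2, a.1.2), a.2⟩), a.1.1.2⟩
      onE := fun a => ⟨(a.1.1.1.1, ⟨(a.1.1.1.2, a.1.2), a.2⟩), a.1.1.2⟩
      src_onE := fun t => rfl
      tgt_onE := fun t => rfl
      onE_triv := fun t => rfl }
    (fun a => ⟨(⟨(a.1.1, a.1.2.1.1), a.2⟩, a.1.2.1.2), a.1.2.2⟩)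
    (fun a => ⟨(⟨(a.1.1, a.1.2.1.1), a.2⟩, a.1.2.1.2), a.1.2.2⟩)
    (fun a => rfl) (fun a => rfl) (fun a => rfl) (fun a => rfl),
    rfl, rfl, fun a => α_ _ _ _, fun t => ?_⟩
  refine nat_of_vid (arr_assoc _ _ _) (arr_assoc _ _ _) ?_ ?_ (h_assoc _ _ _)
  · exact top_cell _ _
  · exact (bot_cell _ _).trans (StrictMonoidal.tensor_assoc _ _ _)

theorem id_comp (R : SituatedSystem U V) : Equivalent (comp (id U) R) R := by
  refine ⟨RGraph.isoMk
    { onV := fun a => a.1.2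
      onE := fun a => a.1.2
      src_onE := fun t => rfl
      tgt_onE := fun t => rfl
      onE_triv := fun t => rfl }
    (fun a => ⟨(R.legL.onV a, a), rfl⟩) (fun a => ⟨(R.legL.onE a, a), rfl⟩)
    (fun a => Subtype.ext (Prod.ext a.2.symm rfl)) (fun a => rfl)
    (fun a => Subtype.ext (Prod.ext a.2.symm rfl)) (fun a => rfl),
    Hom.ext (funext fun a => a.2.symm) (funext fun a => a.2.symm), rfl, fun a => λ_ _, fun t => ?_⟩
  refine nat_of_vid (arr_lunit _) (arr_lunit _) ?_ ?_ ?_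
  · exact top_cell _ _
  · exact (bot_cell _ _).trans (StrictMonoidal.unit_tensor _)
  · exact hid_h _ ((left_cell _ _).trans (congrArg _ t.2.symm))

theorem comp_id (R : SituatedSystem U V) : Equivalent (comp R (id V)) R := by
  refine ⟨RGraph.isoMk
    { onV := fun a => a.1.1
      onE := fun a => a.1.1
      src_onE := fun t => rfl
      tgt_onE := fun t => rfl
      onE_triv := fun t => rfl }
    (fun a => ⟨(a, R.legR.onV a), rfl⟩) (fun a => ⟨(a, R.legR.onE a), rfl⟩)
    (fun a => Subtype.ext (Prod.ext rfl a.2)) (fun a => rfl)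
    (fun a => Subtype.ext (Prod.ext rfl a.2)) (fun a => rfl),
    rfl, Hom.ext (funext fun a => a.2) (funext fun a => a.2), fun a => ρ_ _, fun t => ?_⟩
  refine nat_of_vid (arr_runit _) (arr_runit _) ?_ ?_ ?_
  · exact top_cell _ _
  · exact (bot_cell _ _).trans (StrictMonoidal.tensor_unit _)
  · exact h_hid _ ((right_cell _ _).trans (congrArg _ t.2))

end SituatedSystem

open SituatedSystem in
/-- The category `S(C)` of situated transition systems. -/
instance : Category.{max (p + 1) (q + 1) u v} (SituatedBoundary.{p, q} C) where
  Hom U V := Quotient (SituatedSystem.setoid U V)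
  id U := Quotient.mk _ (SituatedSystem.id U)
  comp f g := Quotient.map₂ SituatedSystem.comp (fun _ _ h _ _ h' => comp_congr h h') f g
  id_comp f := by induction f using Quotient.ind; exact Quotient.sound (SituatedSystem.id_comp _)
  comp_id f := by induction f using Quotient.ind; exact Quotient.sound (SituatedSystem.comp_id _)
  assoc f g h := by
    induction f using Quotient.ind; induction g using Quotient.ind; induction h using Quotient.ind
    exact Quotient.sound (SituatedSystem.comp_assoc _ _ _)

/-! ### The monoidal structure -/

namespace SituatedSystem

open PreCell

local infixl:65 " ∣ₕ " => PreCell.hcomp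
local infixl:60 " ∕ᵥ " => PreCell.vcomp

variable {U V W U' V' W' : SituatedBoundary.{p, q} C}

theorem top_hid_h (X : Exchange C) (a : PreCell C) : (hid X ∣ₕ a).top = a.top := by
  simp [StrictMonoidal.unit_tensor]

theorem bot_h_hid (a : PreCell C) (X : Exchange C) : (a ∣ₕ hid X).bot = a.bot := by
  simp [StrictMonoidal.tensor_unit]

/-- A commuting square of systems, with two opposite sides given by homomorphisms. -/
theorem square {R : SituatedSystem U V} {R' : SituatedSystem U' V'}
    (f : RGraph.Hom U.graph U'.graph) (hf : f.comp U'.sit = U.sit)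
    (g : RGraph.Hom V.graph V'.graph) (hg : g.comp V'.sit = V.sit)
    (iV : Function.Injective f.onV) (iE : Function.Injective f.onE) (α : R.apex ≅ R'.apex)
    (hL : RGraph.Hom.comp α.hom R'.legL = R.legL.comp f)
    (hR : RGraph.Hom.comp α.hom R'.legR = R.legR.comp g)
    (ho : ∀ a, R.obj a = R'.obj (α.hom.onV a)) (hc : ∀ t, R.cell t = R'.cell (α.hom.onE t)) :
    Equivalent (comp R (ofHom g hg)) (comp (ofHom f hf) R') := by
  have L₁ : ∀ a, R'.legL.onV (α.hom.onV a) = f.onV (R.legL.onV a) :=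
    fun a => congrFun (congrArg RGraph.Hom.onV hL) a
  have L₂ : ∀ a, R'.legL.onE (α.hom.onE a) = f.onE (R.legL.onE a) :=
    fun a => congrFun (congrArg RGraph.Hom.onE hL) a
  refine ⟨RGraph.isoMk
    { onV := fun a => ⟨(R.legL.onV a.1.1, α.hom.onV a.1.1), (L₁ _).symm⟩
      onE := fun a => ⟨(R.legL.onE a.1.1, α.hom.onE a.1.1), (L₂ _).symm⟩
      src_onE := fun t => Subtype.ext (Prod.ext (R.legL.src_onE _) (α.hom.src_onE _))
      tgt_onE := fun t => Subtype.ext (Prod.ext (R.legL.tgt_onE _) (α.hom.tgt_onE _))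
      onE_triv := fun t => Subtype.ext (Prod.ext (R.legL.onE_triv _) (α.hom.onE_triv _)) }
    (fun a => ⟨(α.inv.onV a.1.2, R.legR.onV (α.inv.onV a.1.2)), rfl⟩)
    (fun a => ⟨(α.inv.onE a.1.2, R.legR.onE (α.inv.onE a.1.2)), rfl⟩)
    (fun a => Subtype.ext (Prod.ext (RGraph.hom_inv_onV α _)
      ((congrArg _ (RGraph.hom_inv_onV α _)).trans a.2)))
    (fun a => Subtype.ext (Prod.ext (iV (by
      refine (L₁ _).symm.trans ((congrArg _ (RGraph.inv_hom_onV α _)).trans a.2.symm)))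
      (RGraph.inv_hom_onV α _)))
    (fun a => Subtype.ext (Prod.ext (RGraph.hom_inv_onE α _)
      ((congrArg _ (RGraph.hom_inv_onE α _)).trans a.2)))
    (fun a => Subtype.ext (Prod.ext (iE (by
      refine (L₂ _).symm.trans ((congrArg _ (RGraph.inv_hom_onE α _)).trans a.2.symm)))
      (RGraph.inv_hom_onE α _))), rfl, ?_,
    fun a => ρ_ _ ≪≫ eqToIso (ho _) ≪≫ (λ_ _).symm, fun t => ?_⟩
  · refine RGraph.Hom.ext (funext fun a => ?_) (funext fun a => ?_)
    · exact (congrFun (congrArg RGraph.Hom.onV hR) a.1.1).trans (congrArg _ a.2)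
    · exact (congrFun (congrArg RGraph.Hom.onE hR) a.1.1).trans (congrArg _ a.2)
  · have key : ∀ {A B : C} (e : A = B), arr ((ρ_ A).hom ≫ eqToHom e ≫ (λ_ B).inv) = vid A := by
      rintro A _ rfl
      rw [eqToHom_refl, Category.id_comp, arr_comp, arr_runit, arr_lunit_inv]
      exact vid_v (vid A) rfl
    refine nat_of_vid (key (ho _)) (key (ho _)) ?_ ?_ ?_
    · refine (top_hid_h _ (R'.cell (α.hom.onE t.1.1))).trans ?_
      rw [← hc, top_cell]; rfl
    · exact (bot_h_hid (R.cell t.1.1) _).trans (bot_cell _ _)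
    · refine (h_hid (R.cell t.1.1) ?_).trans ((hc _).trans (hid_h _ ?_).symm)
      · rw [right_cell]; exact congrArg _ t.2
      · rw [← hc, left_cell]; rfl

theorem ofHom_congr {f g : RGraph.Hom U.graph V.graph} (hf : f.comp V.sit = U.sit)
    (hg : g.comp V.sit = U.sit) (h : f = g) : Equivalent (ofHom f hf) (ofHom g hg) := by
  subst h; exact Equivalent.refl _

theorem ofHom_comp (f : RGraph.Hom U.graph V.graph) (hf : f.comp V.sit = U.sit)
    (g : RGraph.Hom V.graph W.graph) (hg : g.comp W.sit = V.sit) :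
    Equivalent (comp (ofHom f hf) (ofHom g hg)) (ofHom (f.comp g) (by rw [← hf, ← hg]; rfl)) := by
  refine ⟨RGraph.isoMk
    { onV := fun a => a.1.1
      onE := fun a => a.1.1
      src_onE := fun t => rfl
      tgt_onE := fun t => rfl
      onE_triv := fun t => rfl }
    (fun a => ⟨(a, f.onV a), rfl⟩) (fun a => ⟨(a, f.onE a), rfl⟩)
    (fun a => Subtype.ext (Prod.ext rfl a.2)) (fun a => rfl)
    (fun a => Subtype.ext (Prod.ext rfl a.2)) (fun a => rfl),
    rfl, RGraph.Hom.ext (funext fun a => congrArg g.onV a.2) (funext fun a => congrArg g.onE a.2),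
    fun a => ρ_ _, fun t => ?_⟩
  refine nat_of_vid (arr_runit _) (arr_runit _) rfl ?_ ?_
  · exact bot_h_hid (hid (U.sit.onE t.1.1)) _
  · refine h_hid (hid (U.sit.onE t.1.1)) ?_
    have e : V.sit.onE (f.onE t.1.1) = U.sit.onE t.1.1 :=
      congrFun (congrArg RGraph.Hom.onE hf) t.1.1
    exact e.symm.trans (congrArg V.sit.onE t.2)

end SituatedSystem

/-- The exchange assigned to an event. -/
def SituatedBoundary.label (U : SituatedBoundary.{p, q} C) (t : U.graph.E) : Exchange C :=
  U.sit.onE t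

/-- The tensor product of situated boundaries: the product of the graphs, situated by
concatenation of exchanges. -/
def SituatedBoundary.tensor (U V : SituatedBoundary.{p, q} C) : SituatedBoundary.{p, q} C where
  graph := U.graph.prod V.graph
  sit :=
    { onV := fun _ => ⟨⟩
      onE := fun t => U.label t.1 ++ V.label t.2
      src_onE := fun _ => rfl
      tgt_onE := fun _ => rfl
      onE_triv := fun a => congrArg₂ (fun X Y : Exchange C => X ++ Y) (U.sit.onE_triv a.1)
        (V.sit.onE_triv a.2) }

/-- The tensor unit: the graph with one vertex and no nontrivial edges. -/
def SituatedBoundary.unit : SituatedBoundary.{p, q} C where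
  graph := RGraph.unit
  sit :=
    { onV := fun _ => ⟨⟩
      onE := fun _ => ([] : Exchange C)
      src_onE := fun _ => rfl
      tgt_onE := fun _ => rfl
      onE_triv := fun _ => rfl }

namespace SituatedSystem

open PreCell

local infixl:65 " ∣ₕ " => PreCell.hcomp
local infixl:60 " ∕ᵥ " => PreCell.vcomp

variable {U V W U' V' W' : SituatedBoundary.{p, q} C}

/-- The associativity homomorphism. -/
def assocHom (U V W : SituatedBoundary.{p, q} C) :
    RGraph.Hom ((U.tensor V).tensor W).graph (U.tensor (V.tensor W)).graph where
  onV a := (a.1.1, a.1.2, a.2)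
  onE a := (a.1.1, a.1.2, a.2)
  src_onE _ := rfl
  tgt_onE _ := rfl
  onE_triv _ := rfl

/-- The inverse of the associativity homomorphism. -/
def assocInv (U V W : SituatedBoundary.{p, q} C) :
    RGraph.Hom (U.tensor (V.tensor W)).graph ((U.tensor V).tensor W).graph where
  onV a := ((a.1, a.2.1), a.2.2)
  onE a := ((a.1, a.2.1), a.2.2)
  src_onE _ := rfl
  tgt_onE _ := rfl
  onE_triv _ := rfl

theorem assocHom_sit (U V W : SituatedBoundary.{p, q} C) :
    (assocHom U V W).comp (U.tensor (V.tensor W)).sit = ((U.tensor V).tensor W).sit :=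
  RGraph.Hom.ext rfl (funext fun _ => (List.append_assoc _ _ _).symm)

theorem assocInv_sit (U V W : SituatedBoundary.{p, q} C) :
    (assocInv U V W).comp ((U.tensor V).tensor W).sit = (U.tensor (V.tensor W)).sit :=
  RGraph.Hom.ext rfl (funext fun _ => List.append_assoc _ _ _)

/-- The left unit homomorphism. -/
def lunitHom (U : SituatedBoundary.{p, q} C) :
    RGraph.Hom (SituatedBoundary.unit.tensor U).graph U.graph where
  onV a := a.2
  onE a := a.2
  src_onE _ := rfl
  tgt_onE _ := rfl
  onE_triv _ := rfl

/-- The inverse of the left unit homomorphism. -/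
def lunitInv (U : SituatedBoundary.{p, q} C) :
    RGraph.Hom U.graph (SituatedBoundary.unit.tensor U).graph where
  onV a := (⟨⟩, a)
  onE a := (⟨⟩, a)
  src_onE _ := rfl
  tgt_onE _ := rfl
  onE_triv _ := rfl

theorem lunitHom_sit (U : SituatedBoundary.{p, q} C) :
    (lunitHom U).comp U.sit = (SituatedBoundary.unit.tensor U).sit := rfl

theorem lunitInv_sit (U : SituatedBoundary.{p, q} C) :
    (lunitInv U).comp (SituatedBoundary.unit.tensor U).sit = U.sit := rfl

/-- The right unit homomorphism. -/
def runitHom (U : SituatedBoundary.{p, q} C) :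
    RGraph.Hom (U.tensor SituatedBoundary.unit).graph U.graph where
  onV a := a.1
  onE a := a.1
  src_onE _ := rfl
  tgt_onE _ := rfl
  onE_triv _ := rfl

/-- The inverse of the right unit homomorphism. -/
def runitInv (U : SituatedBoundary.{p, q} C) :
    RGraph.Hom U.graph (U.tensor SituatedBoundary.unit).graph where
  onV a := (a, ⟨⟩)
  onE a := (a, ⟨⟩)
  src_onE _ := rfl
  tgt_onE _ := rfl
  onE_triv _ := rfl

theorem runitHom_sit (U : SituatedBoundary.{p, q} C) :
    (runitHom U).comp U.sit = (U.tensor SituatedBoundary.unit).sit :=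
  RGraph.Hom.ext rfl (funext fun _ => (List.append_nil _).symm)

theorem runitInv_sit (U : SituatedBoundary.{p, q} C) :
    (runitInv U).comp (U.tensor SituatedBoundary.unit).sit = U.sit :=
  RGraph.Hom.ext rfl (funext fun _ => List.append_nil _)

theorem prod_sit {f : RGraph.Hom U.graph V.graph} (hf : f.comp V.sit = U.sit)
    {g : RGraph.Hom U'.graph V'.graph} (hg : g.comp V'.sit = U'.sit) :
    (f.prod g : RGraph.Hom (U.tensor U').graph (V.tensor V').graph).comp (V.tensor V').sit =
      (U.tensor U').sit := by
  refine RGraph.Hom.ext rfl (funext fun t => ?_)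
  exact congrArg₂ (fun X Y : Exchange C => X ++ Y) (congrFun (congrArg RGraph.Hom.onE hf) t.1)
    (congrFun (congrArg RGraph.Hom.onE hg) t.2)

/-- The isomorphism of boundaries given by an isomorphism of graphs that preserves the
situations. -/
def isoOfHom (f : RGraph.Hom U.graph V.graph) (g : RGraph.Hom V.graph U.graph)
    (hf : f.comp V.sit = U.sit) (hg : g.comp U.sit = V.sit)
    (h₁ : f.comp g = RGraph.Hom.id _) (h₂ : g.comp f = RGraph.Hom.id _) : U ≅ V where
  hom := Quotient.mk _ (ofHom f hf)
  inv := Quotient.mk _ (ofHom g hg)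
  hom_inv_id := Quotient.sound ((ofHom_comp f hf g hg).trans (ofHom_congr _ _ h₁))
  inv_hom_id := Quotient.sound ((ofHom_comp g hg f hf).trans (ofHom_congr _ _ h₂))

variable [SymmetricCategory C]

theorem top_tensor_cell (R : SituatedSystem U V) (S : SituatedSystem U' V') (t : R.apex.E)
    (t' : S.apex.E) : (PreCell.tensor (R.cell t) (S.cell t')).top =
      R.obj (R.apex.src t) ⊗ S.obj (S.apex.src t') := by simp

theorem bot_tensor_cell (R : SituatedSystem U V) (S : SituatedSystem U' V') (t : R.apex.E)
    (t' : S.apex.E) : (PreCell.tensor (R.cell t) (S.cell t')).bot =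
      R.obj (R.apex.tgt t) ⊗ S.obj (S.apex.tgt t') := by simp

/-- The tensor product of situated transition systems: the product of the spans, with tensor
products of cells as situation. -/
def tensor (R : SituatedSystem U V) (S : SituatedSystem U' V') :
    SituatedSystem (U.tensor U') (V.tensor V') where
  apex := R.apex.prod S.apex
  legL := R.legL.prod S.legL
  legR := R.legR.prod S.legR
  sit :=
    { onV := fun a => (R.obj a.1 ⊗ S.obj a.2 : C)
      onE := fun t => ⟨PreCell.tensor (R.cell t.1) (S.cell t.2),
        (wf_tensor _ _).2 ⟨wf_cell _ _, wf_cell _ _⟩⟩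
      src_onE := fun t => top_tensor_cell R S t.1 t.2
      tgt_onE := fun t => bot_tensor_cell R S t.1 t.2
      onE_triv := fun a => Subtype.ext ((congrArg₂ _ (cell_triv _ _) (cell_triv _ _)).trans
        (vid_tensor_vid _ _)) }
  coh_left := RGraph.Hom.ext rfl (funext fun t => (left_tensor _ _).trans
    (congrArg₂ (fun X Y : Exchange C => X ++ Y) (left_cell _ _) (left_cell _ _)))
  coh_right := RGraph.Hom.ext rfl (funext fun t => (right_tensor _ _).trans
    (congrArg₂ (fun X Y : Exchange C => X ++ Y) (right_cell _ _) (right_cell _ _)))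

theorem tensor_congr {R R' : SituatedSystem U V} {S S' : SituatedSystem U' V'}
    (h : Equivalent R R') (h' : Equivalent S S') :
    Equivalent (tensor R S) (tensor R' S') := by
  obtain ⟨α, h₁, h₂, ι, h⟩ := h
  obtain ⟨β, h₁', h₂', κ, h'⟩ := h'
  refine ⟨RGraph.isoMk (RGraph.Hom.prod α.hom β.hom)
    (fun a => (α.inv.onV a.1, β.inv.onV a.2)) (fun a => (α.inv.onE a.1, β.inv.onE a.2))
    (fun a => Prod.ext (RGraph.hom_inv_onV α _) (RGraph.hom_inv_onV β _))
    (fun a => Prod.ext (RGraph.inv_hom_onV α _) (RGraph.inv_hom_onV β _))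
    (fun a => Prod.ext (RGraph.hom_inv_onE α _) (RGraph.hom_inv_onE β _))
    (fun a => Prod.ext (RGraph.inv_hom_onE α _) (RGraph.inv_hom_onE β _)),
    congrArg₂ RGraph.Hom.prod h₁ h₁', congrArg₂ RGraph.Hom.prod h₂ h₂',
    fun a => MonoidalCategory.tensorIso (ι a.1) (κ a.2), fun t => ?_⟩
  exact tensor_conj _ _ _ _ (top_cell _ _) (bot_cell _ _)
    ((top_cell _ _).trans (congrArg _ (α.hom.src_onE _)))
    ((bot_cell _ _).trans (congrArg _ (α.hom.tgt_onE _))) (top_cell _ _) (bot_cell _ _)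
    ((top_cell _ _).trans (congrArg _ (β.hom.src_onE _)))
    ((bot_cell _ _).trans (congrArg _ (β.hom.tgt_onE _))) (h t.1) (h' t.2)

theorem ofHom_tensor (f : RGraph.Hom U.graph V.graph) (hf : f.comp V.sit = U.sit)
    (g : RGraph.Hom U'.graph V'.graph) (hg : g.comp V'.sit = U'.sit) :
    Equivalent (tensor (ofHom f hf) (ofHom g hg)) (ofHom (f.prod g) (prod_sit hf hg)) := by
  refine ⟨Iso.refl _, rfl, rfl, fun a => ρ_ _, fun t => ?_⟩
  refine nat_of_vid (arr_runit _) (arr_runit _) rfl ?_ ?_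
  · exact (bot_tensor (hid (U.sit.onE t.1)) (hid (U'.sit.onE t.2))).trans (StrictMonoidal.tensor_unit _)
  · exact hid_tensor_hid _ _

/-- The middle-four interchange of objects. -/
def middle (A B D E : C) : (A ⊗ B) ⊗ (D ⊗ E) ≅ (A ⊗ D) ⊗ (B ⊗ E) :=
  α_ A B (D ⊗ E) ≪≫ whiskerLeftIso A ((α_ B D E).symm ≪≫ whiskerRightIso (β_ B D) E ≪≫ α_ D B E) ≪≫
    (α_ A D (B ⊗ E)).symm

theorem arr_middle (A B D E : C) :
    arr (middle A B D E).hom = (vid A ∣ₕ (braid B D ∣ₕ vid E)) := by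
  simp only [middle, Iso.trans_hom, whiskerLeftIso_hom, Iso.symm_hom, whiskerRightIso_hom,
    arr_comp, arr_whiskerLeft, arr_whiskerRight, arr_assoc, arr_assoc_inv]
  change _ ∕ᵥ (_ ∣ₕ (_ ∕ᵥ ((braid B D ∣ₕ _) ∕ᵥ _)) ∕ᵥ _) = _
  rw [v_vid (braid B D ∣ₕ _), vid_v (braid B D ∣ₕ _), vid_v, v_vid] <;>
    simp [StrictMonoidal.tensor_assoc]

theorem tensor_comp (R : SituatedSystem U V) (S : SituatedSystem V W) (R' : SituatedSystem U' V')
    (S' : SituatedSystem V' W') :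
    Equivalent (tensor (comp R S) (comp R' S')) (comp (tensor R R') (tensor S S')) := by
  refine ⟨RGraph.isoMk
    { onV := fun a => ⟨((a.1.1.1, a.2.1.1), (a.1.1.2, a.2.1.2)), Prod.ext a.1.2 a.2.2⟩
      onE := fun a => ⟨((a.1.1.1, a.2.1.1), (a.1.1.2, a.2.1.2)), Prod.ext a.1.2 a.2.2⟩
      src_onE := fun t => rfl
      tgt_onE := fun t => rfl
      onE_triv := fun t => rfl }
    (fun a => (⟨(a.1.1.1, a.1.2.1), congrArg Prod.fst a.2⟩,
      ⟨(a.1.1.2, a.1.2.2), congrArg Prod.snd a.2⟩))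
    (fun a => (⟨(a.1.1.1, a.1.2.1), congrArg Prod.fst a.2⟩,
      ⟨(a.1.1.2, a.1.2.2), congrArg Prod.snd a.2⟩))
    (fun a => rfl) (fun a => rfl) (fun a => rfl) (fun a => rfl),
    rfl, rfl, fun a => middle _ _ _ _, fun t => ?_⟩
  have h₁ : (R.cell t.1.1.1).right = (S.cell t.1.1.2).left := by
    rw [right_cell, left_cell]; exact congrArg _ t.1.2
  have h₂ : (R'.cell t.2.1.1).right = (S'.cell t.2.1.2).left := by
    rw [right_cell, left_cell]; exact congrArg _ t.2.2
  have := tensor_interchange _ _ _ _ (wf_cell R' t.2.1.1) (wf_cell S t.1.1.2) h₁ h₂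
  simp only [top_cell, bot_cell, ← arr_middle] at this
  exact this

theorem tensor_assoc (R : SituatedSystem U V) (S : SituatedSystem U' V')
    (T : SituatedSystem W W') :
    Equivalent (comp (tensor (tensor R S) T) (ofHom (assocHom V V' W') (assocHom_sit _ _ _)))
      (comp (ofHom (assocHom U U' W) (assocHom_sit _ _ _)) (tensor R (tensor S T))) := by
  refine square _ _ _ _ ?_ ?_ (RGraph.isoMk
    { onV := fun a => (a.1.1, a.1.2, a.2)
      onE := fun a => (a.1.1, a.1.2, a.2)
      src_onE := fun _ => rfl
      tgt_onE := fun _ => rfl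
      onE_triv := fun _ => rfl }
    (fun a => ((a.1, a.2.1), a.2.2)) (fun a => ((a.1, a.2.1), a.2.2))
    (fun _ => rfl) (fun _ => rfl) (fun _ => rfl) (fun _ => rfl)) rfl rfl
    (fun a => StrictMonoidal.tensor_assoc _ _ _) (fun t => PreCell.tensor_assoc _ _ _)
  · exact fun a b h => congrArg (assocInv U U' W).onV h
  · exact fun a b h => congrArg (assocInv U U' W).onE h

theorem tensor_lunit (R : SituatedSystem U V) :
    Equivalent (comp (tensor (id SituatedBoundary.unit) R) (ofHom (lunitHom V) (lunitHom_sit _)))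
      (comp (ofHom (lunitHom U) (lunitHom_sit _)) R) := by
  refine square _ _ _ _ ?_ ?_ (RGraph.isoMk
    { onV := fun a => a.2
      onE := fun a => a.2
      src_onE := fun _ => rfl
      tgt_onE := fun _ => rfl
      onE_triv := fun _ => rfl }
    (fun a => (⟨⟩, a)) (fun a => (⟨⟩, a))
    (fun _ => rfl) (fun _ => rfl) (fun _ => rfl) (fun _ => rfl)) rfl rfl
    (fun a => StrictMonoidal.unit_tensor _)
    (fun t => (congrArg (fun x => PreCell.tensor x _) hid_nil).trans (PreCell.unit_tensor _))
  · exact fun a b h => congrArg (lunitInv U).onV h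
  · exact fun a b h => congrArg (lunitInv U).onE h

theorem tensor_runit (R : SituatedSystem U V) :
    Equivalent (comp (tensor R (id SituatedBoundary.unit)) (ofHom (runitHom V) (runitHom_sit _)))
      (comp (ofHom (runitHom U) (runitHom_sit _)) R) := by
  refine square _ _ _ _ ?_ ?_ (RGraph.isoMk
    { onV := fun a => a.1
      onE := fun a => a.1
      src_onE := fun _ => rfl
      tgt_onE := fun _ => rfl
      onE_triv := fun _ => rfl }
    (fun a => (a, ⟨⟩)) (fun a => (a, ⟨⟩))
    (fun _ => rfl) (fun _ => rfl) (fun _ => rfl) (fun _ => rfl)) rfl rfl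
    (fun a => StrictMonoidal.tensor_unit _)
    (fun t => (congrArg (fun x => PreCell.tensor _ x) hid_nil).trans (PreCell.tensor_unit _))
  · exact fun a b h => congrArg (runitInv U).onV h
  · exact fun a b h => congrArg (runitInv U).onE h

/-- The tensor product of arrows. -/
def homTensor (f : U ⟶ V) (g : U' ⟶ V') : U.tensor U' ⟶ V.tensor V' :=
  Quotient.map₂ tensor (fun _ _ h _ _ h' => tensor_congr h h') f g

end SituatedSystem

section

variable [SymmetricCategory C]

open SituatedSystem

/-- The operations of the monoidal structure on `S(C)`. -/
instance : MonoidalCategoryStruct (SituatedBoundary.{p, q} C) where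
  tensorObj U V := U.tensor V
  tensorUnit := SituatedBoundary.unit
  tensorHom f g := homTensor f g
  whiskerLeft U _ _ g := homTensor (𝟙 U) g
  whiskerRight f V := homTensor f (𝟙 V)
  associator U V W := isoOfHom (assocHom U V W) (assocInv U V W) (assocHom_sit U V W)
    (assocInv_sit U V W) rfl rfl
  leftUnitor U := isoOfHom (lunitHom U) (lunitInv U) (lunitHom_sit U) (lunitInv_sit U) rfl rfl
  rightUnitor U := isoOfHom (runitHom U) (runitInv U) (runitHom_sit U) (runitInv_sit U) rfl rfl

/-- The monoidal category `S(C)` of situated transition systems. -/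
instance : MonoidalCategory (SituatedBoundary.{p, q} C) :=
  MonoidalCategory.ofTensorHom
    (id_tensorHom_id := fun _ _ => Quotient.sound (ofHom_tensor _ _ _ _))
    (id_tensorHom := fun _ _ _ _ => rfl)
    (tensorHom_id := fun _ _ => rfl)
    (tensorHom_comp_tensorHom := fun f₁ f₂ g₁ g₂ => by
      induction f₁ using Quotient.ind; induction f₂ using Quotient.ind
      induction g₁ using Quotient.ind; induction g₂ using Quotient.ind
      exact (Quotient.sound (SituatedSystem.tensor_comp _ _ _ _)).symm)
    (associator_naturality := fun f₁ f₂ f₃ => by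
      induction f₁ using Quotient.ind; induction f₂ using Quotient.ind
      induction f₃ using Quotient.ind
      exact Quotient.sound (SituatedSystem.tensor_assoc _ _ _))
    (leftUnitor_naturality := fun f => by
      induction f using Quotient.ind
      exact Quotient.sound (SituatedSystem.tensor_lunit _))
    (rightUnitor_naturality := fun f => by
      induction f using Quotient.ind
      exact Quotient.sound (SituatedSystem.tensor_runit _))
    (pentagon := fun U V W X => Quotient.sound
      ((comp_congr (ofHom_tensor _ _ _ _)
        ((comp_congr (Equivalent.refl _) (ofHom_tensor _ _ _ _)).trans (ofHom_comp _ _ _ _))).trans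
          ((ofHom_comp _ _ _ _).trans
            ((ofHom_congr _ _ rfl).trans (ofHom_comp (assocHom (U.tensor V) W X)
              (assocHom_sit _ _ _) (assocHom U V (W.tensor X)) (assocHom_sit _ _ _)).symm))))
    (triangle := fun U V => Quotient.sound
      ((comp_congr (Equivalent.refl _) (ofHom_tensor _ _ _ _)).trans ((ofHom_comp _ _ _ _).trans
        ((ofHom_congr _ _ rfl).trans (ofHom_tensor _ _ _ _).symm))))

end

end systems

end Situated

/-!
Compact closure of the category of situated transition systems.

The tensor product of cells is not commutative: in `tensor a b`, the cell `a` happens before `b`.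
A symmetry `X ⊗ Y → Y ⊗ X` of exchanges has to undo this order, which may require giving out a
resource before it has come in. Duals in the resource theory make this possible. If `B` is dual to
`A`, the cup and cap of the duality turn `A•` on a vertical boundary into the object `B` on a
horizontal one (`isConversion_bullet`), just as the corners do for `A∘` and `A`. So every exchange `X`
has an object `size X` and mutually inverse conversion cells `inn X`, `out X` (`isConversion`).
Converting the left and right boundaries of a cell gives a cell with trivial sides, its flattening
`flat`. Flattening is injective (`eq_of_flat_eq`), every cell with trivial sides between the right
objects is a flattening (`flat_bend`), and horizontal composites and tensor products are computed by
`flat_hcomp` and `flat_tensor`. Hence the symmetry of the resource theory yields symmetry cells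
`PreCell.swap` that are natural (`tensor_h_swap`) and satisfy the hexagons, and the units and counits
of the objects `size X` yield duals of exchanges (`exists_isDual`).

These cells label spans of graphs. The symmetry of `U` and `V` is the exchange of the factors of
`U × V`, labelled by symmetry cells. The dual of `U` is the same graph with dual exchanges; unit and
counit are the spans with apex `U` and the diagonal as one leg, labelled by the units and counits of
exchanges. All these systems assign the unit object to every state, and for such stateless systems
composites and tensor products reduce to operations on cells, so that the hexagon and snake
equations follow from those of exchanges.
-/

namespace Situated

namespace PreCell

local infixl:65 " ∣ₕ " => PreCell.hcomp
local infixl:60 " ∕ᵥ " => PreCell.vcomp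

attribute [local simp] StrictMonoidal.tensor_assoc StrictMonoidal.unit_tensor
  StrictMonoidal.tensor_unit

variable {C : Type u} [Category.{v} C] [MonoidalCategory C] [StrictMonoidal C]

/-! ### Converting exchanges into objects -/

/-- The cells `i` and `o` convert between the exchange `X` on a vertical boundary and the object
`P` on a horizontal one: `i` takes in `X` from the left and leaves `P` at the bottom, `o` takes `P`
at the top and gives out `X` to the right, and the two are mutually inverse in the sense of the
yanking equations. -/
structure IsConversion (X : Exchange C) (P : C) (i o : PreCell C) : Prop where
  wf_in : i.WF
  top_in : i.top = 𝟙_ C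
  bot_in : i.bot = P
  left_in : i.left = X
  right_in : i.right = []
  wf_out : o.WF
  top_out : o.top = P
  bot_out : o.bot = 𝟙_ C
  left_out : o.left = []
  right_out : o.right = X
  out_h_in : (o ∣ₕ i) = vid P
  in_v_out : (i ∕ᵥ o) = hid X

theorem isConversion_nil : IsConversion ([] : Exchange C) (𝟙_ C) (vid (𝟙_ C)) (vid (𝟙_ C)) := by
  constructor
  case in_v_out => rw [hid_nil, v_vid _ (by simp)]
  all_goals simp [← vid_tensor]

theorem isConversion_circ (A : C) : IsConversion [(A, .circ)] A (circIn A) (circOut A) := by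
  constructor <;> simp [circ_h, circ_v]

theorem snake_right (A B : C) [ExactPairing A B] :
    ((vid B ∣ₕ arr (η_ A B)) ∕ᵥ (arr (ε_ A B) ∣ₕ vid B)) = vid B := by
  have h := congrArg arr (ExactPairing.coevaluation_evaluation A B)
  simp only [arr_comp, arr_whiskerLeft, arr_whiskerRight, arr_assoc_inv, arr_runit,
    arr_lunit_inv] at h
  rw [vid_v _ (by simp), vid_v _ (by simp)] at h
  exact h

theorem snake_left (A B : C) [ExactPairing A B] :
    ((arr (η_ A B) ∣ₕ vid A) ∕ᵥ (vid A ∣ₕ arr (ε_ A B))) = vid A := by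
  have h := congrArg arr (ExactPairing.evaluation_coevaluation A B)
  simp only [arr_comp, arr_whiskerLeft, arr_whiskerRight, arr_assoc, arr_lunit,
    arr_runit_inv] at h
  rw [vid_v _ (by simp), vid_v _ (by simp)] at h
  exact h

/-- The conversion of `A•` into a dual `B` of `A`: the unit of the duality creates `A ⊗ B`, and `A`
leaves to the left; conversely, `A` enters from the right and is cancelled against `B` by the
counit. -/
theorem isConversion_bullet (A B : C) [ExactPairing A B] :
    IsConversion [(A, .bullet)] B (arr (η_ A B) ∕ᵥ (bulletOut A ∣ₕ vid B))
      ((vid B ∣ₕ bulletIn A) ∕ᵥ arr (ε_ A B)) := by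
  constructor
  case out_h_in =>
    -- delay the counit so that the two corners meet in the same row
    rw [← vid_v (A := B) ((vid B ∣ₕ bulletIn A) ∕ᵥ arr (ε_ A B)) (by simp),
      ← v_vid (A := B) (arr (η_ A B) ∕ᵥ (bulletOut A ∣ₕ vid B)) (by simp), v_assoc,
      ← interchange (by simp) (by simp) (by simp) (by simp),
      ← interchange (by simp) (by simp) (by simp) (by simp), h_assoc, ← h_assoc (bulletIn A),
      bullet_h, ← vid_tensor, ← vid_tensor, vid_v _ (by simp), snake_right]
  case in_v_out =>
    -- the corner that takes in `A` moves up, and the one that gives out `A` moves down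
    rw [v_assoc, ← v_assoc (bulletOut A ∣ₕ vid B),
      ← vidI_h (vid B ∣ₕ bulletIn A) (by simp)]
    have e₁ : ((bulletOut A ∣ₕ vid B) ∕ᵥ (vid (𝟙_ C) ∣ₕ (vid B ∣ₕ bulletIn A))) =
        ((vid A ∣ₕ (vid B ∣ₕ bulletIn A)) ∕ᵥ (bulletOut A ∣ₕ vid (B ⊗ A))) := by
      have h := split_ab (a := bulletOut A) (b := vid B ∣ₕ bulletIn A) (by simp) (by simp)
      rw [split_ba (by simp) (by simp)] at h
      simpa using h.symm
    have e₂ : (arr (η_ A B) ∕ᵥ (vid A ∣ₕ (vid B ∣ₕ bulletIn A))) =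
        (bulletIn A ∕ᵥ (arr (η_ A B) ∣ₕ vid A)) := by
      have h := split_ab (a := arr (η_ A B)) (b := bulletIn A) (by simp) (by simp)
      rw [split_ba (by simp) (by simp)] at h
      simp only [top_arr, bot_arr, top_bulletIn, bot_bulletIn] at h
      rw [vidI_h _ (by simp), h_vidI _ (by simp), vid_tensor, h_assoc] at h
      exact h.symm
    have e₃ : ((bulletOut A ∣ₕ vid (B ⊗ A)) ∕ᵥ arr (ε_ A B)) =
        ((vid A ∣ₕ arr (ε_ A B)) ∕ᵥ bulletOut A) := by
      have h := split_ab (a := bulletOut A) (b := arr (ε_ A B)) (by simp) (by simp)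
      rw [split_ba (by simp) (by simp)] at h
      simp only [top_arr, bot_arr, top_bulletOut, bot_bulletOut] at h
      rw [vidI_h _ (by simp), h_vidI _ (by simp)] at h
      exact h.symm
    rw [e₁, v_assoc, e₃, ← v_assoc, e₂, v_assoc, ← v_assoc (arr (η_ A B) ∣ₕ vid A), snake_left,
      vid_v _ (by simp), bullet_v]
  all_goals simp

namespace IsConversion

variable {X Y : Exchange C} {P Q : C} {i o i' o' : PreCell C}

/-- Taking in `X` and then doing `c` becomes `c` once `X` is supplied from `P`. -/
theorem out_h (h : IsConversion X P i o) {c : PreCell C} {T : C} (hl : c.left = [])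
    (ht : c.top = P ⊗ T) : (o ∣ₕ ((i ∣ₕ vid T) ∕ᵥ c)) = c := by
  obtain ⟨-, h₁, h₂, h₃, h₄, -, h₅, h₆, h₇, h₈, h₉, -⟩ := h
  rw [← v_vid (A := 𝟙_ C) o h₆, ← interchange (by simp [h₃, h₈]) (by simp [hl]) (by simp [h₆])
    (by simp [h₂, ht]), ← h_assoc, h₉, ← vid_tensor, vidI_h _ hl, vid_v _ ht]

theorem h_in (h : IsConversion X P i o) {c : PreCell C} {B : C} (hr : c.right = [])
    (hb : c.bot = B ⊗ P) : ((c ∕ᵥ (vid B ∣ₕ o)) ∣ₕ i) = c := by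
  obtain ⟨-, h₁, h₂, h₃, h₄, -, h₅, h₆, h₇, h₈, h₉, -⟩ := h
  rw [← vid_v (A := 𝟙_ C) i h₁, ← interchange (by simp [hr]) (by simp [h₃, h₈])
    (by simp [h₅, hb]) (by simp [h₁]), h_assoc, h₉, ← vid_tensor, h_vidI _ hr, v_vid _ hb]

theorem in_v_out_h (h : IsConversion X P i o) {c : PreCell C} {T : C} (hl : c.left = X)
    (ht : c.top = T) : ((i ∣ₕ vid T) ∕ᵥ (o ∣ₕ c)) = c := by
  obtain ⟨-, h₁, h₂, h₃, h₄, -, h₅, h₆, h₇, h₈, -, h₉⟩ := h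
  rw [interchange (by simp [h₄]) (by simp [h₈, hl]) (by simp [h₂, h₅]) (by simp [ht]), h₉,
    vid_v _ ht, hid_h _ hl]

theorem h_in_v_out (h : IsConversion X P i o) {c : PreCell C} {B : C} (hr : c.right = X)
    (hb : c.bot = B) : ((c ∣ₕ i) ∕ᵥ (vid B ∣ₕ o)) = c := by
  obtain ⟨-, h₁, h₂, h₃, h₄, -, h₅, h₆, h₇, h₈, -, h₉⟩ := h
  rw [interchange (by simp [h₃, hr]) (by simp [h₇]) (by simp [hb]) (by simp [h₂, h₅]), h₉,
    v_vid _ hb, h_hid _ hr]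

/-- Conversions are closed under the tensor product. -/
theorem tensor [SymmetricCategory C] (h : IsConversion X P i o) (h' : IsConversion Y Q i' o') :
    IsConversion (X ++ Y) (P ⊗ Q) (PreCell.tensor i i') (PreCell.tensor o o') := by
  obtain ⟨hw, h₁, h₂, h₃, h₄, kw, h₅, h₆, h₇, h₈, h₉, h₁₀⟩ := h
  obtain ⟨hw', h₁', h₂', h₃', h₄', kw', h₅', h₆', h₇', h₈', h₉', h₁₀'⟩ := h'
  constructor
  case out_h_in =>
    have h := tensor_interchange o o' i i' kw' hw (by simp [*]) (by simp [*])
    simp only [h₉, h₉', h₆, h₆', h₁, h₂, h₁', h₂', h₅, h₅', vid_tensor_vid, braid_unit_left,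
      braid_unit_right, ← vid_tensor] at h
    rw [v_vid _ (by simp), vid_v _ (by simp [*])] at h
    exact h.symm
  case in_v_out =>
    -- sliding `i'` and `o` along the wire `P` brings them into one row
    have e₁ := slide P i' hw'
    have e₂ := slide_inv Q o kw
    simp only [h₁', h₂', h₃', h₄', braid_unit_right, cross_nil] at e₁
    simp only [h₅, h₆, h₇, h₈, braid_unit_left, cross_nil] at e₂
    rw [vid_v _ (by simp [*])] at e₁
    rw [v_vid _ (by simp [*])] at e₂
    simp only [PreCell.tensor, h₁', h₂, h₃', h₄, h₆, h₅', h₇', h₈, cross_nil]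
    rw [h_vidI _ h₄, vidI_h _ h₇', v_assoc, ← v_assoc (_ ∣ₕ i'), ← e₂,
      ← v_assoc (_ ∣ₕ i'), e₁, interchange (by simp [*]) (by simp [*]) (by simp [*]) (by simp [*]),
      vid_v _ h₅, v_vid _ h₂', split_ba (by simp [*]) (by simp [*]), h₁', h₆, h_vidI _ (by simp [*]),
      vidI_h _ (by simp [*])]
    rw [v_assoc, ← v_assoc i, h₁₀, h₁₀', hid_append]
  all_goals simp [*]

end IsConversion

/-! ### Flattening cells -/

variable (hC : HasDuals C)

/-- The object of a polarized object: `A` for `A∘`, and a dual of `A` for `A•`. -/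
noncomputable def sizeOne : C × Polarity → C
  | (A, .circ) => A
  | (A, .bullet) => (hC A).choose

/-- The duality in `C` turns `A•` into `(A*)∘`, so that every letter converts into an object. -/
theorem exists_isConversion_one (x : C × Polarity) :
    ∃ i o, IsConversion [x] (sizeOne hC x) i o := by
  obtain ⟨A, _ | _⟩ := x
  · exact ⟨_, _, isConversion_circ A⟩
  · let := (hC A).choose_spec.some
    exact ⟨_, _, isConversion_bullet A (hC A).choose⟩

/-- The object of an exchange: the tensor product of the objects of its letters. -/
noncomputable def size : Exchange C → C
  | [] => 𝟙_ C
  | x :: X => sizeOne hC x ⊗ size X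

theorem size_append (X Y : Exchange C) : size hC (X ++ Y) = size hC X ⊗ size hC Y := by
  induction X with
  | nil => exact (StrictMonoidal.unit_tensor _).symm
  | cons x X ih =>
    exact (congrArg (sizeOne hC x ⊗ ·) ih).trans (StrictMonoidal.tensor_assoc _ _ _).symm

variable [SymmetricCategory C]

/-- The cell that converts an exchange on the left boundary into its object. -/
noncomputable def inn : Exchange C → PreCell C
  | [] => vid (𝟙_ C)
  | x :: X => tensor (exists_isConversion_one hC x).choose (inn X)

/-- The cell that converts the object of an exchange into the exchange on the right boundary. -/
noncomputable def out : Exchange C → PreCell C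
  | [] => vid (𝟙_ C)
  | x :: X => tensor (exists_isConversion_one hC x).choose_spec.choose (out X)

theorem inn_append (X Y : Exchange C) : inn hC (X ++ Y) = tensor (inn hC X) (inn hC Y) := by
  induction X with
  | nil => exact (unit_tensor _).symm
  | cons x X ih => exact (congrArg (tensor _) ih).trans (tensor_assoc _ _ _).symm

theorem out_append (X Y : Exchange C) : out hC (X ++ Y) = tensor (out hC X) (out hC Y) := by
  induction X with
  | nil => exact (unit_tensor _).symm
  | cons x X ih => exact (congrArg (tensor _) ih).trans (tensor_assoc _ _ _).symm

theorem isConversion (X : Exchange C) : IsConversion X (size hC X) (inn hC X) (out hC X) := by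
  induction X with
  | nil => exact isConversion_nil
  | cons x X ih => exact (exists_isConversion_one hC x).choose_spec.choose_spec.tensor ih

variable (X Y : Exchange C)

@[simp] theorem wf_inn : (inn hC X).WF := (isConversion hC X).wf_in
@[simp] theorem top_inn : (inn hC X).top = 𝟙_ C := (isConversion hC X).top_in
@[simp] theorem bot_inn : (inn hC X).bot = size hC X := (isConversion hC X).bot_in
@[simp] theorem left_inn : (inn hC X).left = X := (isConversion hC X).left_in
@[simp] theorem right_inn : (inn hC X).right = [] := (isConversion hC X).right_in
@[simp] theorem wf_out : (out hC X).WF := (isConversion hC X).wf_out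
@[simp] theorem top_out : (out hC X).top = size hC X := (isConversion hC X).top_out
@[simp] theorem bot_out : (out hC X).bot = 𝟙_ C := (isConversion hC X).bot_out
@[simp] theorem left_out : (out hC X).left = [] := (isConversion hC X).left_out
@[simp] theorem right_out : (out hC X).right = X := (isConversion hC X).right_out

/-- The cell with trivial sides obtained from `a` by converting its left boundary into an object
on top and its right boundary into an object at the bottom. -/
noncomputable def flat (a : PreCell C) : PreCell C :=
  out hC a.left ∣ₕ a ∣ₕ inn hC a.right

@[simp] theorem left_flat (a : PreCell C) : (flat hC a).left = [] := by simp [flat]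
@[simp] theorem right_flat (a : PreCell C) : (flat hC a).right = [] := by simp [flat]
@[simp] theorem top_flat (a : PreCell C) : (flat hC a).top = size hC a.left ⊗ a.top := by
  simp [flat]
@[simp] theorem bot_flat (a : PreCell C) : (flat hC a).bot = a.bot ⊗ size hC a.right := by
  simp [flat]
@[simp] theorem wf_flat {a : PreCell C} (h : a.WF) : (flat hC a).WF := by simp [flat, h]

/-- Flattening loses no information. -/
theorem eq_of_flat_eq {a b : PreCell C} (hl : a.left = b.left) (hr : a.right = b.right)
    (ht : a.top = b.top) (hb : a.bot = b.bot) (h : flat hC a = flat hC b) : a = b := by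
  have key (c : PreCell C) :
      ((inn hC c.left ∣ₕ vid c.top) ∕ᵥ (flat hC c ∕ᵥ (vid c.bot ∣ₕ out hC c.right))) = c := by
    rw [flat, (isConversion hC c.right).h_in_v_out (by simp) (by simp),
      (isConversion hC c.left).in_v_out_h rfl rfl]
  rw [← key a, ← key b, h, hl, hr, ht, hb]

/-- The cell with left boundary `X` and right boundary `Y` whose flattening is the given cell from
the object of `X` to the object of `Y`. -/
noncomputable def bend (g : PreCell C) : PreCell C := inn hC X ∕ᵥ (g ∕ᵥ out hC Y)

/-- Flattening turns horizontal composition into vertical composition: the exchange in the middle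
becomes an object handed over from `a` to `b`. -/
theorem flat_hcomp {a b : PreCell C} (h : a.right = b.left) :
    flat hC (a ∣ₕ b) = ((flat hC a ∣ₕ vid b.top) ∕ᵥ (vid a.bot ∣ₕ flat hC b)) := by
  have h₁ := (isConversion hC b.left).in_v_out_h (c := b ∣ₕ inn hC b.right) (T := b.top)
    (by simp) (by simp)
  rw [flat, flat, flat, h_assoc _ (inn hC a.right), h_assoc (out hC b.left), h,
    interchange (by simp [h]) (by simp) (by simp) (by simp), v_vid _ (by simp), h₁]
  simp only [left_hcomp, right_hcomp, h_assoc]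

theorem flat_hid : flat hC (hid X) = vid (size hC X) := by
  rw [flat, left_hid, right_hid, h_hid _ (by simp), (isConversion hC X).out_h_in]

theorem flat_vcomp_right {a c : PreCell C} (h : a.bot = c.top) (hl : c.left = [])
    (hr : c.right = []) :
    flat hC (a ∕ᵥ c) = (flat hC a ∕ᵥ (c ∣ₕ vid (size hC a.right))) := by
  simp only [flat, left_vcomp, right_vcomp, hl, hr, List.append_nil]
  rw [← vidI_h c hl, interchange (by simp) (by simp [hr]) (by simp [h]) (by simp),
    interchange (by simp) (by simp [hl]) (by simp) (by simp [h]), vidI_h _ hl,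
    v_vid _ (by simp), v_vid _ (by simp)]

theorem flat_vcomp_left {a c : PreCell C} (h : c.bot = a.top) (hl : c.left = [])
    (hr : c.right = []) :
    flat hC (c ∕ᵥ a) = ((vid (size hC a.left) ∣ₕ c) ∕ᵥ flat hC a) := by
  simp only [flat, left_vcomp, right_vcomp, hl, hr, List.nil_append]
  rw [← h_vidI (vid _ ∣ₕ c) (by simp [hr]),
    interchange (by simp [hr]) (by simp) (by simp [h]) (by simp),
    interchange (by simp [hl]) (by simp) (by simp) (by simp [h]),
    vid_v _ (by simp), vid_v _ (by simp)]

section bend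

variable {X Y} {g : PreCell C}

@[simp] theorem top_bend : (bend hC X Y g).top = 𝟙_ C := by simp [bend]
@[simp] theorem bot_bend : (bend hC X Y g).bot = 𝟙_ C := by simp [bend]

theorem left_bend (hl : g.left = []) : (bend hC X Y g).left = X := by simp [bend, hl]
theorem right_bend (hr : g.right = []) : (bend hC X Y g).right = Y := by simp [bend, hr]

theorem wf_bend (hg : g.WF) (ht : g.top = size hC X) (hb : g.bot = size hC Y) :
    (bend hC X Y g).WF := by simp [bend, *]

theorem flat_bend (hl : g.left = []) (hr : g.right = []) (ht : g.top = size hC X)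
    (hb : g.bot = size hC Y) : flat hC (bend hC X Y g) = g := by
  have h₁ := (isConversion hC X).out_h (c := g ∕ᵥ out hC Y) (T := 𝟙_ C) (by simp [hl])
    (by simp [ht])
  have h₂ := (isConversion hC Y).h_in (c := g) (B := 𝟙_ C) hr (by simp [hb])
  rw [h_vidI _ (by simp)] at h₁
  rw [vidI_h _ (by simp)] at h₂
  rw [flat, left_bend hC hl, right_bend hC hr, bend, h₁, h₂]

theorem bend_vid_nil : bend hC [] [] (vid (𝟙_ C)) = vid (𝟙_ C) := by
  have h : (vid (𝟙_ C) ∕ᵥ vid (𝟙_ C)) = vid (𝟙_ C) := vid_v _ rfl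
  change (vid (𝟙_ C) ∕ᵥ (vid (𝟙_ C) ∕ᵥ vid (𝟙_ C))) = _
  rw [h, h]

end bend

theorem tensor_of_trivial {a b : PreCell C} (ha : a.right = []) (hb : b.left = []) :
    tensor a b = (a ∣ₕ b) := by
  rw [tensor, ha, hb, cross_nil, cross_nil, ← split_ab ha hb]

/-- Flattening a tensor product of cells gives the tensor product of the flattenings, up to the
symmetries that sort the boundaries. -/
theorem flat_tensor {a b : PreCell C} (ha : a.WF) (hb : b.WF) :
    ((flat hC a ∣ₕ flat hC b) ∕ᵥ (vid a.bot ∣ₕ (braid (size hC a.right) b.bot ∣ₕ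
        vid (size hC b.right)))) =
      ((vid (size hC a.left) ∣ₕ (braid a.top (size hC b.left) ∣ₕ vid b.top)) ∕ᵥ
        flat hC (tensor a b)) := by
  have h₁ := tensor_interchange (out hC a.left) (out hC b.left) a b (by simp) ha (by simp)
    (by simp)
  have h₂ := tensor_interchange (out hC a.left ∣ₕ a) (out hC b.left ∣ₕ b) (inn hC a.right)
    (inn hC b.right) (by simp [hb]) (by simp) (by simp) (by simp)
  simp only [bot_out, top_out, braid_unit_right, ← vid_tensor, bot_hcomp, top_hcomp, top_inn,
    bot_inn, braid_unit_left, StrictMonoidal.unit_tensor, StrictMonoidal.tensor_unit] at h₁ h₂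
  rw [v_vid _ (by simp)] at h₁
  rw [vid_v _ (by simp), h₁] at h₂
  rw [← tensor_of_trivial (by simp) (by simp), flat, flat, h₂, flat, left_tensor, right_tensor,
    inn_append, out_append, ← h_vidI (vid (size hC a.left) ∣ₕ _) (by simp),
    interchange (b := vid (𝟙_ C)) (d := tensor (inn hC _) _) (by simp) (by simp) (by simp)
      (by simp), vid_v (tensor (inn hC _) _) (by simp), h_vidI _ (by simp)]

/-! ### The symmetry of exchanges -/

theorem braid_nat_of_trivial {a b : PreCell C} (ha : a.WF) (hb : b.WF) (hal : a.left = [])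
    (har : a.right = []) (hbl : b.left = []) (hbr : b.right = []) :
    ((a ∣ₕ b) ∕ᵥ braid a.bot b.bot) = (braid a.top b.top ∕ᵥ (b ∣ₕ a)) := by
  have h₁ := slide a.bot b hb
  have h₂ := slide_inv b.top a ha
  simp only [hbl, hbr, hal, har, cross_nil] at h₁ h₂
  rw [split_ab har hbl, v_assoc, h₁, ← v_assoc, ← h₂, v_assoc,
    ← split_ba hbr hal]

/-- Sorting the two pairs of objects, and then swapping them componentwise, is swapping the pairs
and then sorting. -/
theorem braid_tensor_tensor (A B D E : C) :
    ((vid A ∣ₕ (braid B D ∣ₕ vid E)) ∕ᵥ ((vid (A ⊗ D) ∣ₕ braid B E) ∕ᵥ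
        (braid A D ∣ₕ vid (E ⊗ B)))) =
      (braid (A ⊗ B) (D ⊗ E) ∕ᵥ (vid D ∣ₕ (braid E A ∣ₕ vid B))) := by
  have h : ((vid D ∣ₕ (braid A E ∣ₕ vid B)) ∕ᵥ (vid D ∣ₕ (braid E A ∣ₕ vid B))) =
      vid (D ⊗ A ⊗ E ⊗ B) := by
    rw [← vidL_v (by simp) (by simp) (by simp), ← v_vidR (by simp) (by simp) (by simp),
      braid_symm]
    simp only [vid_tensor, h_assoc]
  rw [braid_tensor_left, braid_tensor_right B, braid_tensor_right A,
    vidL_v (by simp) (by simp) (by simp), v_vidR (by simp) (by simp) (by simp)]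
  simp only [h_assoc, v_assoc]
  rw [h, v_vid _ (by simp)]
  simp only [vid_tensor, h_assoc]

/-- The symmetry cell, from `X ⊗ Y` on the left to `Y ⊗ X` on the right. -/
noncomputable def swap : PreCell C := bend hC (X ++ Y) (Y ++ X) (braid (size hC X) (size hC Y))

@[simp] theorem top_swap : (swap hC X Y).top = 𝟙_ C := by simp [swap]
@[simp] theorem bot_swap : (swap hC X Y).bot = 𝟙_ C := by simp [swap]
@[simp] theorem left_swap : (swap hC X Y).left = X ++ Y := left_bend _ (by simp)
@[simp] theorem right_swap : (swap hC X Y).right = Y ++ X := right_bend _ (by simp)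
@[simp] theorem wf_swap : (swap hC X Y).WF :=
  wf_bend _ (by simp) (by simp [size_append]) (by simp [size_append])

theorem flat_swap : flat hC (swap hC X Y) = braid (size hC X) (size hC Y) :=
  flat_bend _ (by simp) (by simp) (by simp [size_append]) (by simp [size_append])

theorem swap_nil : swap hC ([] : Exchange C) [] = vid (𝟙_ C) := by
  rw [swap]
  change bend hC [] [] (braid (𝟙_ C) (𝟙_ C)) = _
  rw [braid_unit_left, bend_vid_nil]

/-- The symmetry cells are natural with respect to the tensor product of cells, although the latter
lets its first factor happen first: after flattening, this is naturality of the symmetry of `C`. -/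
theorem tensor_h_swap {a b : PreCell C} (ha : a.WF) (hb : b.WF) :
    ((tensor a b ∣ₕ swap hC a.right b.right) ∕ᵥ braid a.bot b.bot) =
      (braid a.top b.top ∕ᵥ (swap hC a.left b.left ∣ₕ tensor b a)) := by
  refine eq_of_flat_eq hC (by simp) (by simp) (by simp) (by simp) ?_
  rw [flat_vcomp_right _ (by simp) (by simp) (by simp),
    flat_vcomp_left _ (by simp) (by simp) (by simp), flat_hcomp _ (by simp),
    flat_hcomp _ (by simp), flat_swap, flat_swap]
  simp only [top_swap, bot_swap, right_hcomp, left_hcomp, right_swap, left_swap, size_append,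
    top_tensor, bot_tensor]
  rw [h_vidI _ (by simp), vidI_h _ (by simp), v_assoc, ← v_assoc _ _ (flat hC (tensor b a))]
  -- both sides agree after composing with the invertible cell that sorts the upper boundary
  have inv : ((vid (size hC a.left) ∣ₕ (braid (size hC b.left) a.top ∣ₕ vid b.top)) ∕ᵥ
      (vid (size hC a.left) ∣ₕ (braid a.top (size hC b.left) ∣ₕ vid b.top))) =
      vid (size hC a.left ⊗ size hC b.left ⊗ a.top ⊗ b.top) := by
    rw [← vidL_v (by simp) (by simp) (by simp), ← v_vidR (by simp) (by simp) (by simp),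
      braid_symm]
    simp only [vid_tensor, h_assoc]
  have cancel {x y : PreCell C} (hx : x.top = size hC a.left ⊗ size hC b.left ⊗ a.top ⊗ b.top)
      (hy : y.top = x.top)
      (h : ((vid (size hC a.left) ∣ₕ (braid a.top (size hC b.left) ∣ₕ vid b.top)) ∕ᵥ x) =
        ((vid (size hC a.left) ∣ₕ (braid a.top (size hC b.left) ∣ₕ vid b.top)) ∕ᵥ y)) :
      x = y := by
    rw [← vid_v x hx, ← vid_v y (hy.trans hx), ← inv, v_assoc, h, v_assoc]
  refine cancel (by simp [size_append]) (by simp [size_append]) ?_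
  have nat := braid_nat_of_trivial (wf_flat hC ha) (wf_flat hC hb) (by simp) (by simp) (by simp)
    (by simp)
  simp only [top_flat, bot_flat] at nat
  rw [← v_assoc, ← flat_tensor hC ha hb, v_assoc, braid_tensor_tensor, ← v_assoc, nat, v_assoc,
    flat_tensor hC hb ha, ← v_assoc, ← braid_tensor_tensor]
  simp only [v_assoc]

/-! ### Cells with trivial top and bottom boundaries -/

section unit

variable {X Y}

theorem flat_hcomp_of_unit {a b : PreCell C} (h : a.right = b.left) (ha : a.bot = 𝟙_ C)
    (hb : b.top = 𝟙_ C) : flat hC (a ∣ₕ b) = (flat hC a ∕ᵥ flat hC b) := by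
  rw [flat_hcomp hC h, ha, hb, h_vidI _ (by simp), vidI_h _ (by simp)]

theorem flat_tensor_of_unit {a b : PreCell C} (ha : a.WF) (hb : b.WF) (hat : a.top = 𝟙_ C)
    (hab : a.bot = 𝟙_ C) (hbt : b.top = 𝟙_ C) (hbb : b.bot = 𝟙_ C) :
    flat hC (tensor a b) = (flat hC a ∣ₕ flat hC b) := by
  have h := flat_tensor hC ha hb
  simp only [hat, hab, hbt, hbb, braid_unit_left, braid_unit_right, ← vid_tensor] at h
  rw [v_vid _ (by simp [hab, hbb]), vid_v _ (by simp [hat, hbt, size_append])] at h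
  exact h.symm

variable (X Y)

theorem swap_h_swap : (swap hC X Y ∣ₕ swap hC Y X) = hid (X ++ Y) := by
  refine eq_of_flat_eq hC (by simp) (by simp) (by simp) (by simp) ?_
  rw [flat_hcomp_of_unit _ (by simp) (by simp) (by simp), flat_swap, flat_swap, flat_hid,
    braid_symm, size_append]

theorem swap_append_right (Z : Exchange C) : swap hC X (Y ++ Z) =
    (tensor (swap hC X Y) (hid Z) ∣ₕ tensor (hid Y) (swap hC X Z)) := by
  refine eq_of_flat_eq hC (by simp) (by simp) (by simp) (by simp) ?_
  rw [flat_hcomp_of_unit _ (by simp) (by simp) (by simp),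
    flat_tensor_of_unit _ (by simp) (by simp) (by simp) (by simp) (by simp) (by simp),
    flat_tensor_of_unit _ (by simp) (by simp) (by simp) (by simp) (by simp) (by simp)]
  simp only [flat_swap, flat_hid, size_append, braid_tensor_right]

theorem swap_append_left (Z : Exchange C) : swap hC (X ++ Y) Z =
    (tensor (hid X) (swap hC Y Z) ∣ₕ tensor (swap hC X Z) (hid Y)) := by
  refine eq_of_flat_eq hC (by simp) (by simp) (by simp) (by simp) ?_
  rw [flat_hcomp_of_unit _ (by simp) (by simp) (by simp),
    flat_tensor_of_unit _ (by simp) (by simp) (by simp) (by simp) (by simp) (by simp),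
    flat_tensor_of_unit _ (by simp) (by simp) (by simp) (by simp) (by simp) (by simp)]
  simp only [flat_swap, flat_hid, size_append, braid_tensor_left]

end unit

/-- `Y` is a dual of the exchange `X`, with unit `n` and counit `e`. The snake equations are equations
between cells with trivial top and bottom boundaries, composed horizontally. -/
structure IsDual (X Y : Exchange C) (n e : PreCell C) : Prop where
  wf_unit : n.WF
  top_unit : n.top = 𝟙_ C
  bot_unit : n.bot = 𝟙_ C
  left_unit : n.left = []
  right_unit : n.right = X ++ Y
  wf_counit : e.WF
  top_counit : e.top = 𝟙_ C
  bot_counit : e.bot = 𝟙_ C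
  left_counit : e.left = Y ++ X
  right_counit : e.right = []
  snake_left : (tensor n (hid X) ∣ₕ tensor (hid X) e) = hid X
  snake_right : (tensor (hid Y) n ∣ₕ tensor e (hid Y)) = hid Y

theorem isDual_nil : IsDual ([] : Exchange C) [] (vid (𝟙_ C)) (vid (𝟙_ C)) := by
  constructor
  case snake_left => rw [hid_nil, vid_tensor_vid, ← vid_tensor]; simp
  case snake_right => rw [hid_nil, vid_tensor_vid, ← vid_tensor]; simp
  all_goals simp

/-- Every exchange has a dual, namely any exchange whose object is dual to its object. -/
theorem exists_isDual (hC : HasDuals C) (X : Exchange C) : ∃ Y n e, IsDual X Y n e := by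
  obtain ⟨D, ⟨hD⟩⟩ := hC (size hC X)
  obtain ⟨Y, rfl⟩ : ∃ Y, D = size hC Y := ⟨[(D, .circ)], (StrictMonoidal.tensor_unit D).symm⟩
  refine ⟨Y, bend hC [] (X ++ Y) (arr (η_ (size hC X) (size hC Y))),
    bend hC (Y ++ X) [] (arr (ε_ (size hC X) (size hC Y))), ?_⟩
  have hn := flat_bend hC (g := arr (η_ (size hC X) (size hC Y))) (X := []) (Y := X ++ Y)
    rfl rfl rfl (size_append hC X Y).symm
  have he := flat_bend hC (g := arr (ε_ (size hC X) (size hC Y))) (X := Y ++ X) (Y := [])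
    rfl rfl (size_append hC Y X).symm rfl
  have wn : (bend hC [] (X ++ Y) (arr (η_ (size hC X) (size hC Y)))).WF :=
    wf_bend _ (by simp) rfl (size_append hC X Y).symm
  have we : (bend hC (Y ++ X) [] (arr (ε_ (size hC X) (size hC Y)))).WF :=
    wf_bend _ (by simp) (size_append hC Y X).symm rfl
  have ln := left_bend hC (g := arr (η_ (size hC X) (size hC Y))) (X := []) (Y := X ++ Y) rfl
  have rn := right_bend hC (g := arr (η_ (size hC X) (size hC Y))) (X := []) (Y := X ++ Y) rfl
  have le := left_bend hC (g := arr (ε_ (size hC X) (size hC Y))) (X := Y ++ X) (Y := []) rfl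
  have re := right_bend hC (g := arr (ε_ (size hC X) (size hC Y))) (X := Y ++ X) (Y := []) rfl
  constructor
  case snake_left =>
    refine eq_of_flat_eq hC (by simp [ln]) (by simp [re]) (by simp) (by simp) ?_
    rw [flat_hcomp_of_unit _ (by simp [rn, le]) (by simp) (by simp),
      flat_tensor_of_unit _ wn (by simp) (by simp) (by simp) (by simp) (by simp),
      flat_tensor_of_unit _ (by simp) we (by simp) (by simp) (by simp) (by simp), hn, he,
      flat_hid, PreCell.snake_left]
  case snake_right =>
    refine eq_of_flat_eq hC (by simp [ln]) (by simp [re]) (by simp) (by simp) ?_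
    rw [flat_hcomp_of_unit _ (by simp [rn, le]) (by simp) (by simp),
      flat_tensor_of_unit _ (by simp) wn (by simp) (by simp) (by simp) (by simp),
      flat_tensor_of_unit _ we (by simp) (by simp) (by simp) (by simp) (by simp), hn, he,
      flat_hid, PreCell.snake_right]
  all_goals first | assumption | simp

/-- The dual of the unit exchange, with its unit and counit, can be taken to be trivial; this makes
the choice of duals compatible with trivial edges. -/
theorem exists_isDual_of_nil (hC : HasDuals C) (X : Exchange C) :
    ∃ Y n e, IsDual X Y n e ∧ (X = [] → Y = [] ∧ n = vid (𝟙_ C) ∧ e = vid (𝟙_ C)) := by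
  by_cases h : X = []
  · subst h
    exact ⟨_, _, _, isDual_nil, fun _ => ⟨rfl, rfl, rfl⟩⟩
  · obtain ⟨Y, n, e, hY⟩ := exists_isDual hC X
    exact ⟨Y, n, e, hY, fun h' => absurd h' h⟩

end PreCell

/-! ### Stateless systems -/

open PreCell

local infixl:65 " ∣ₕ " => PreCell.hcomp
local infixl:60 " ∕ᵥ " => PreCell.vcomp

variable {C : Type u} [Category.{v} C] [MonoidalCategory C] [StrictMonoidal C]
variable {U V W U' V' W' : SituatedBoundary.{p, q} C}

/-- A situated transition system in which no state holds a resource: all objects assigned to states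
are the unit, so that all cells have trivial top and bottom boundaries. -/
structure StatelessSystem (U V : SituatedBoundary.{p, q} C) :
    Type (max (p + 1) (q + 1) u v) where
  apex : RGraph.{p, q}
  legL : RGraph.Hom apex U.graph
  legR : RGraph.Hom apex V.graph
  cell : apex.E → PreCell C
  wf_cell (t : apex.E) : (cell t).WF
  top_cell (t : apex.E) : (cell t).top = 𝟙_ C
  bot_cell (t : apex.E) : (cell t).bot = 𝟙_ C
  left_cell (t : apex.E) : (cell t).left = U.sit.onE (legL.onE t)
  right_cell (t : apex.E) : (cell t).right = V.sit.onE (legR.onE t)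
  cell_triv (a : apex.V) : cell (apex.triv a) = vid (𝟙_ C)

namespace StatelessSystem

/-- The underlying situated transition system. -/
def toSystem (R : StatelessSystem U V) : SituatedSystem U V where
  apex := R.apex
  legL := R.legL
  legR := R.legR
  sit :=
    { onV := fun _ => 𝟙_ C
      onE := fun t => ⟨R.cell t, R.wf_cell t⟩
      src_onE := R.top_cell
      tgt_onE := R.bot_cell
      onE_triv := fun a => Subtype.ext (R.cell_triv a) }
  coh_left := RGraph.Hom.ext rfl (funext R.left_cell)
  coh_right := RGraph.Hom.ext rfl (funext R.right_cell)

/-- The arrow represented by a stateless system. -/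
def hom (R : StatelessSystem U V) : U ⟶ V := Quotient.mk _ R.toSystem

/-- The composite of stateless systems `R` and `S` may be computed on any graph that is a pullback
of their legs. -/
theorem hom_comp_hom {R : StatelessSystem U V} {S : StatelessSystem V W} {T : StatelessSystem U W}
    (f : RGraph.Hom T.apex R.apex) (g : RGraph.Hom T.apex S.apex)
    (hf : f.comp R.legL = T.legL) (hg : g.comp S.legR = T.legR)
    (hfg : f.comp R.legR = g.comp S.legL)
    (iV : ∀ a b, f.onV a = f.onV b → g.onV a = g.onV b → a = b)
    (iE : ∀ a b, f.onE a = f.onE b → g.onE a = g.onE b → a = b)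
    (sV : ∀ a b, R.legR.onV a = S.legL.onV b → ∃ c, f.onV c = a ∧ g.onV c = b)
    (sE : ∀ a b, R.legR.onE a = S.legL.onE b → ∃ c, f.onE c = a ∧ g.onE c = b)
    (hc : ∀ t, T.cell t = (R.cell (f.onE t) ∣ₕ S.cell (g.onE t))) :
    R.hom ≫ S.hom = T.hom := by
  -- the comparison map into the canonical pullback is bijective on vertices and on edges
  choose kV kV₁ kV₂ using sV
  choose kE kE₁ kE₂ using sE
  refine Quotient.sound (SituatedSystem.Equivalent.symm ?_)
  refine ⟨RGraph.isoMk
    { onV := fun a => ⟨(f.onV a, g.onV a), congrFun (congrArg RGraph.Hom.onV hfg) a⟩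
      onE := fun t => ⟨(f.onE t, g.onE t), congrFun (congrArg RGraph.Hom.onE hfg) t⟩
      src_onE := fun t => Subtype.ext (Prod.ext (f.src_onE _) (g.src_onE _))
      tgt_onE := fun t => Subtype.ext (Prod.ext (f.tgt_onE _) (g.tgt_onE _))
      onE_triv := fun t => Subtype.ext (Prod.ext (f.onE_triv _) (g.onE_triv _)) }
    (fun a => kV a.1.1 a.1.2 a.2) (fun t => kE t.1.1 t.1.2 t.2)
    (fun a => iV _ _ (kV₁ _ _ _) (kV₂ _ _ _))
    (fun a => Subtype.ext (Prod.ext (kV₁ _ _ _) (kV₂ _ _ _)))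
    (fun t => iE _ _ (kE₁ _ _ _) (kE₂ _ _ _))
    (fun t => Subtype.ext (Prod.ext (kE₁ _ _ _) (kE₂ _ _ _))), hf, hg, fun a => (λ_ _).symm,
    fun t => ?_⟩
  refine SituatedSystem.nat_of_vid (arr_lunit_inv _) (arr_lunit_inv _) ?_ (T.bot_cell t) (hc t)
  exact (top_hcomp (R.cell (f.onE t)) _).trans ((congrArg₂ _ (R.top_cell _) (S.top_cell _)).trans
    (StrictMonoidal.unit_tensor _))

/-- The tensor product of stateless systems. -/
def tensor [SymmetricCategory C] (R : StatelessSystem U V) (S : StatelessSystem U' V') :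
    StatelessSystem (U.tensor U') (V.tensor V') where
  apex := R.apex.prod S.apex
  legL := R.legL.prod S.legL
  legR := R.legR.prod S.legR
  cell t := PreCell.tensor (R.cell t.1) (S.cell t.2)
  wf_cell t := (wf_tensor _ _).2 ⟨R.wf_cell _, S.wf_cell _⟩
  top_cell t := by simp [R.top_cell, S.top_cell, StrictMonoidal.unit_tensor]
  bot_cell t := by simp [R.bot_cell, S.bot_cell, StrictMonoidal.unit_tensor]
  left_cell t := (left_tensor _ _).trans
    (congrArg₂ (fun X Y : Exchange C => X ++ Y) (R.left_cell _) (S.left_cell _))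
  right_cell t := (right_tensor _ _).trans
    (congrArg₂ (fun X Y : Exchange C => X ++ Y) (R.right_cell _) (S.right_cell _))
  cell_triv a := (congrArg₂ _ (R.cell_triv _) (S.cell_triv _)).trans
    ((vid_tensor_vid _ _).trans (congrArg vid (StrictMonoidal.unit_tensor _)))

theorem hom_tensor_hom [SymmetricCategory C] (R : StatelessSystem U V)
    (S : StatelessSystem U' V') : R.hom ⊗ₘ S.hom = (R.tensor S).hom := by
  refine Quotient.sound ⟨Iso.refl _, rfl, rfl, fun a => λ_ _, fun t => ?_⟩
  refine SituatedSystem.nat_of_vid (arr_lunit _) (arr_lunit _) ?_ ?_ rfl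
  · exact (R.tensor S).top_cell t
  · exact (R.tensor S).bot_cell t

end StatelessSystem

/-- A homomorphism of graphs, together with cells with trivial top and bottom boundaries that
mediate between the situations. It acts as a stateless system whose left leg is the identity. -/
@[ext]
structure LabelledHom (U V : SituatedBoundary.{p, q} C) : Type (max p q u v) where
  map : RGraph.Hom U.graph V.graph
  cell : U.graph.E → PreCell C
  wf_cell (t : U.graph.E) : (cell t).WF
  top_cell (t : U.graph.E) : (cell t).top = 𝟙_ C
  bot_cell (t : U.graph.E) : (cell t).bot = 𝟙_ C
  left_cell (t : U.graph.E) : (cell t).left = U.sit.onE t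
  right_cell (t : U.graph.E) : (cell t).right = V.sit.onE (map.onE t)
  cell_triv (a : U.graph.V) : cell (U.graph.triv a) = vid (𝟙_ C)

namespace StatelessSystem

/-- The stateless system of a labelled homomorphism. -/
def ofMap (m : LabelledHom U V) : StatelessSystem U V :=
  { m with
    apex := U.graph
    legL := RGraph.Hom.id _
    legR := m.map }

/-- Postcomposition of a stateless system with a labelled homomorphism. -/
def postcomp (R : StatelessSystem U V) (m : LabelledHom V W) : StatelessSystem U W where
  apex := R.apex
  legL := R.legL
  legR := R.legR.comp m.map
  cell t := R.cell t ∣ₕ m.cell (R.legR.onE t)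
  wf_cell t := (wf_hcomp _ _).2
    ⟨R.wf_cell _, m.wf_cell _, (R.right_cell t).trans (m.left_cell _).symm⟩
  top_cell t := by simp [R.top_cell, m.top_cell, StrictMonoidal.unit_tensor]
  bot_cell t := by simp [R.bot_cell, m.bot_cell, StrictMonoidal.unit_tensor]
  left_cell t := (left_hcomp _ _).trans (R.left_cell t)
  right_cell t := (right_hcomp _ _).trans (m.right_cell _)
  cell_triv a := by
    rw [R.legR.onE_triv, R.cell_triv, m.cell_triv, ← vid_tensor, StrictMonoidal.unit_tensor]

theorem hom_comp_ofMap (R : StatelessSystem U V) (m : LabelledHom V W) :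
    R.hom ≫ (ofMap m).hom = (R.postcomp m).hom :=
  hom_comp_hom (T := R.postcomp m) (RGraph.Hom.id R.apex) R.legR rfl rfl rfl (fun _ _ h _ => h)
    (fun _ _ h _ => h) (fun a _ h => ⟨a, rfl, h⟩) (fun a _ h => ⟨a, rfl, h⟩) (fun _ => rfl)

end StatelessSystem

namespace LabelledHom

open StatelessSystem (ofMap)

/-- The arrow represented by a labelled homomorphism. -/
def hom (m : LabelledHom U V) : U ⟶ V := (ofMap m).hom

/-- A homomorphism that preserves the situations, labelled by horizontal identities. -/
def ofHom (f : RGraph.Hom U.graph V.graph) (h : f.comp V.sit = U.sit) : LabelledHom U V where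
  map := f
  cell t := hid (U.sit.onE t)
  wf_cell _ := wf_hid _
  top_cell _ := rfl
  bot_cell _ := rfl
  left_cell _ := rfl
  right_cell t := (congrFun (congrArg RGraph.Hom.onE h) t).symm
  cell_triv a := (congrArg hid (U.sit.onE_triv a)).trans hid_nil

/-- The identity. -/
def id (U : SituatedBoundary.{p, q} C) : LabelledHom U U := ofHom (RGraph.Hom.id _) rfl

/-- Composition of labelled homomorphisms. -/
def comp (m : LabelledHom U V) (n : LabelledHom V W) : LabelledHom U W :=
  { (ofMap m).postcomp n with
    map := m.map.comp n.map }

theorem cell_ofHom_comp (f : RGraph.Hom U.graph V.graph) (h) (m : LabelledHom V W)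
    (t : U.graph.E) : ((ofHom f h).comp m).cell t = m.cell (f.onE t) :=
  hid_h _ ((m.left_cell _).trans (congrFun (congrArg RGraph.Hom.onE h) t))

theorem cell_comp_ofHom (m : LabelledHom U V) (f : RGraph.Hom V.graph W.graph) (h)
    (t : U.graph.E) : (m.comp (ofHom f h)).cell t = m.cell t :=
  h_hid _ (m.right_cell _)

/-- The product of labelled homomorphisms. -/
def prod [SymmetricCategory C] (m : LabelledHom U V) (n : LabelledHom U' V') :
    LabelledHom (U.tensor U') (V.tensor V') :=
  { (ofMap m).tensor (ofMap n) with
    map := m.map.prod n.map }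

theorem hom_id (U : SituatedBoundary.{p, q} C) : (id U).hom = 𝟙 U := rfl

theorem hom_comp (m : LabelledHom U V) (n : LabelledHom V W) :
    m.hom ≫ n.hom = (m.comp n).hom := StatelessSystem.hom_comp_ofMap _ _

theorem hom_prod [SymmetricCategory C] (m : LabelledHom U V) (n : LabelledHom U' V') :
    m.hom ⊗ₘ n.hom = (m.prod n).hom := StatelessSystem.hom_tensor_hom _ _

variable [SymmetricCategory C]

open SituatedSystem (assocHom assocInv assocHom_sit assocInv_sit)

theorem associator_hom (U V W : SituatedBoundary.{p, q} C) :
    (α_ U V W).hom = (ofHom (assocHom U V W) (assocHom_sit U V W)).hom := rfl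

theorem associator_inv (U V W : SituatedBoundary.{p, q} C) :
    (α_ U V W).inv = (ofHom (assocInv U V W) (assocInv_sit U V W)).hom := rfl

/-! ### The symmetry of situated transition systems -/

/-- The symmetry: the exchange of factors, labelled by the symmetry cells. -/
noncomputable def swap (hC : HasDuals C) (U V : SituatedBoundary.{p, q} C) :
    LabelledHom (U.tensor V) (V.tensor U) where
  map :=
    { onV := fun a => (a.2, a.1)
      onE := fun t => (t.2, t.1)
      src_onE := fun _ => rfl
      tgt_onE := fun _ => rfl
      onE_triv := fun _ => rfl }
  cell t := PreCell.swap hC (U.sit.onE t.1) (V.sit.onE t.2)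
  wf_cell _ := wf_swap _ _ _
  top_cell _ := top_swap _ _ _
  bot_cell _ := bot_swap _ _ _
  left_cell _ := left_swap _ _ _
  right_cell _ := right_swap _ _ _
  cell_triv a := (congrArg₂ (PreCell.swap hC) (U.sit.onE_triv a.1) (V.sit.onE_triv a.2)).trans
    (swap_nil hC)

variable (hC : HasDuals C)

theorem swap_comp_swap (U V : SituatedBoundary.{p, q} C) :
    (swap hC U V).comp (swap hC V U) = id (U.tensor V) :=
  LabelledHom.ext rfl (funext fun _ => swap_h_swap hC _ _)

theorem swap_hexagon_forward (U V W : SituatedBoundary.{p, q} C) :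
    (ofHom (assocHom U V W) (assocHom_sit U V W)).comp ((swap hC U (V.tensor W)).comp
        (ofHom (assocHom V W U) (assocHom_sit V W U))) =
      ((swap hC U V).prod (id W)).comp ((ofHom (assocHom V U W) (assocHom_sit V U W)).comp
        ((id V).prod (swap hC U W))) := by
  refine LabelledHom.ext rfl (funext fun t => ?_)
  exact (cell_ofHom_comp _ _ _ t).trans ((cell_comp_ofHom _ _ _ _).trans
    ((swap_append_right hC _ _ _).trans (congrArg (PreCell.hcomp _)
      (cell_ofHom_comp _ (assocHom_sit V U W) ((id V).prod (swap hC U W))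
        ((t.1.2, t.1.1), t.2)).symm)))

theorem swap_hexagon_reverse (U V W : SituatedBoundary.{p, q} C) :
    (ofHom (assocInv U V W) (assocInv_sit U V W)).comp ((swap hC (U.tensor V) W).comp
        (ofHom (assocInv W U V) (assocInv_sit W U V))) =
      ((id U).prod (swap hC V W)).comp ((ofHom (assocInv U W V) (assocInv_sit U W V)).comp
        ((swap hC U W).prod (id V))) := by
  refine LabelledHom.ext rfl (funext fun t => ?_)
  exact (cell_ofHom_comp _ _ _ t).trans ((cell_comp_ofHom _ _ _ _).trans
    ((swap_append_left hC _ _ _).trans (congrArg (PreCell.hcomp _)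
      (cell_ofHom_comp _ (assocInv_sit U W V) ((swap hC U W).prod (id V))
        (t.1, (t.2.2, t.2.1))).symm)))

end LabelledHom

/-- The symmetry is natural: the apexes differ by exchanging factors, and the isomorphism of the
situations is the symmetry of `C` on the objects assigned to states. -/
theorem SituatedSystem.tensor_comp_swap [SymmetricCategory C] (hC : HasDuals C)
    (R : SituatedSystem U V) (S : SituatedSystem U' V') :
    Equivalent (comp (tensor R S) (StatelessSystem.ofMap (LabelledHom.swap hC V V')).toSystem)
      (comp (StatelessSystem.ofMap (LabelledHom.swap hC U U')).toSystem (tensor S R)) := by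
  refine ⟨RGraph.isoMk
    { onV := fun a => ⟨((R.legL.onV a.1.1.1, S.legL.onV a.1.1.2), (a.1.1.2, a.1.1.1)), rfl⟩
      onE := fun t => ⟨((R.legL.onE t.1.1.1, S.legL.onE t.1.1.2), (t.1.1.2, t.1.1.1)), rfl⟩
      src_onE := fun t => Subtype.ext (Prod.ext (Prod.ext (R.legL.src_onE _) (S.legL.src_onE _)) rfl)
      tgt_onE := fun t => Subtype.ext (Prod.ext (Prod.ext (R.legL.tgt_onE _) (S.legL.tgt_onE _)) rfl)
      onE_triv := fun t =>
        Subtype.ext (Prod.ext (Prod.ext (R.legL.onE_triv _) (S.legL.onE_triv _)) rfl) }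
    (fun a => ⟨((a.1.2.2, a.1.2.1), (R.legR.onV a.1.2.2, S.legR.onV a.1.2.1)), rfl⟩)
    (fun t => ⟨((t.1.2.2, t.1.2.1), (R.legR.onE t.1.2.2, S.legR.onE t.1.2.1)), rfl⟩)
    (fun a => Subtype.ext (Prod.ext rfl a.2))
    (fun a => Subtype.ext (Prod.ext (congrArg Prod.swap a.2).symm rfl))
    (fun t => Subtype.ext (Prod.ext rfl t.2))
    (fun t => Subtype.ext (Prod.ext (congrArg Prod.swap t.2).symm rfl)),
    rfl, RGraph.Hom.ext (funext fun a => congrArg Prod.swap a.2)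
      (funext fun t => congrArg Prod.swap t.2),
    fun a => ρ_ _ ≪≫ β_ (R.obj a.1.1.1) (S.obj a.1.1.2) ≪≫ (λ_ _).symm, fun t => ?_⟩
  have key (A B : C) :
      arr ((ρ_ (A ⊗ B)).hom ≫ (β_ A B).hom ≫ (λ_ (B ⊗ A)).inv) = braid A B := by
    rw [arr_comp, arr_comp, arr_runit, arr_lunit_inv, vid_v _ (by simp), v_vid _ (by simp)]
    rfl
  obtain ⟨⟨⟨r, s⟩, v⟩, h : (R.legR.onE r, S.legR.onE s) = v⟩ := t
  subst h
  have h := tensor_h_swap hC (R.wf_cell r) (S.wf_cell s)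
  simp only [right_cell, left_cell, top_cell, bot_cell, ← key] at h
  exact h

/-- The symmetry of the category of situated transition systems over a compact closed resource
theory. -/
@[reducible]
noncomputable def symmetricCategory [SymmetricCategory C] (hC : HasDuals C) :
    SymmetricCategory (SituatedBoundary.{p, q} C) where
  braiding U V :=
    { hom := (LabelledHom.swap hC U V).hom
      inv := (LabelledHom.swap hC V U).hom
      hom_inv_id := (LabelledHom.hom_comp _ _).trans
        (congrArg LabelledHom.hom (LabelledHom.swap_comp_swap hC U V))
      inv_hom_id := (LabelledHom.hom_comp _ _).trans
        (congrArg LabelledHom.hom (LabelledHom.swap_comp_swap hC V U)) }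
  braiding_naturality_right U _ _ f := by
    induction f using Quotient.ind
    exact Quotient.sound (SituatedSystem.tensor_comp_swap hC _ _)
  braiding_naturality_left f U := by
    induction f using Quotient.ind
    exact Quotient.sound (SituatedSystem.tensor_comp_swap hC _ _)
  hexagon_forward U V W := by
    simp only [← id_tensorHom, ← tensorHom_id, ← LabelledHom.hom_id, LabelledHom.associator_hom,
      LabelledHom.hom_prod]
    exact ((congrArg _ (LabelledHom.hom_comp _ _)).trans (LabelledHom.hom_comp _ _)).trans
      ((congrArg LabelledHom.hom (LabelledHom.swap_hexagon_forward hC U V W)).trans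
        ((congrArg _ (LabelledHom.hom_comp _ _)).trans (LabelledHom.hom_comp _ _)).symm)
  hexagon_reverse U V W := by
    simp only [← id_tensorHom, ← tensorHom_id, ← LabelledHom.hom_id, LabelledHom.associator_inv,
      LabelledHom.hom_prod]
    exact ((congrArg _ (LabelledHom.hom_comp _ _)).trans (LabelledHom.hom_comp _ _)).trans
      ((congrArg LabelledHom.hom (LabelledHom.swap_hexagon_reverse hC U V W)).trans
        ((congrArg _ (LabelledHom.hom_comp _ _)).trans (LabelledHom.hom_comp _ _)).symm)
  symmetry U V := (LabelledHom.hom_comp _ _).trans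
    (congrArg LabelledHom.hom (LabelledHom.swap_comp_swap hC U V))

/-! ### Duals of situated boundaries -/

section dual

variable [SymmetricCategory C]

/-- A dual of an exchange, chosen so that the empty exchange is its own dual. -/
noncomputable def dualExchange (hC : HasDuals C) (X : Exchange C) : Exchange C :=
  (exists_isDual_of_nil hC X).choose

/-- The unit of the duality of an exchange and its dual. -/
noncomputable def coevCell (hC : HasDuals C) (X : Exchange C) : PreCell C :=
  (exists_isDual_of_nil hC X).choose_spec.choose

/-- The counit of the duality of an exchange and its dual. -/
noncomputable def evCell (hC : HasDuals C) (X : Exchange C) : PreCell C :=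
  (exists_isDual_of_nil hC X).choose_spec.choose_spec.choose

theorem isDual (hC : HasDuals C) (X : Exchange C) :
    IsDual X (dualExchange hC X) (coevCell hC X) (evCell hC X) :=
  (exists_isDual_of_nil hC X).choose_spec.choose_spec.choose_spec.1

theorem dual_nil (hC : HasDuals C) : dualExchange hC [] = [] ∧ coevCell hC [] = vid (𝟙_ C) ∧
    evCell hC [] = vid (𝟙_ C) :=
  (exists_isDual_of_nil hC ([] : Exchange C)).choose_spec.choose_spec.choose_spec.2 rfl

variable (hC : HasDuals C) (U : SituatedBoundary.{p, q} C)

/-- The dual of a situated boundary: the same graph, situated by the dual exchanges. -/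
noncomputable def SituatedBoundary.dual : SituatedBoundary.{p, q} C where
  graph := U.graph
  sit :=
    { onV := fun _ => ⟨⟩
      onE := fun t => dualExchange hC (U.sit.onE t)
      src_onE := fun _ => rfl
      tgt_onE := fun _ => rfl
      onE_triv := fun a => (congrArg (dualExchange hC) (U.sit.onE_triv a)).trans (dual_nil hC).1 }

namespace StatelessSystem

/-- The unit of the duality: its right leg is the diagonal. -/
noncomputable def coev : StatelessSystem SituatedBoundary.unit (U.tensor (U.dual hC)) where
  apex := U.graph
  legL := ⟨fun _ => ⟨⟩, fun _ => ⟨⟩, fun _ => rfl, fun _ => rfl, fun _ => rfl⟩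
  legR := ⟨fun a => (a, a), fun t => (t, t), fun _ => rfl, fun _ => rfl, fun _ => rfl⟩
  cell t := coevCell hC (U.sit.onE t)
  wf_cell _ := (isDual hC _).wf_unit
  top_cell _ := (isDual hC _).top_unit
  bot_cell _ := (isDual hC _).bot_unit
  left_cell _ := (isDual hC _).left_unit
  right_cell _ := (isDual hC _).right_unit
  cell_triv a := (congrArg (coevCell hC) (U.sit.onE_triv a)).trans (dual_nil hC).2.1

/-- The counit of the duality: its left leg is the diagonal. -/
noncomputable def ev : StatelessSystem ((U.dual hC).tensor U) SituatedBoundary.unit where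
  apex := U.graph
  legL := ⟨fun a => (a, a), fun t => (t, t), fun _ => rfl, fun _ => rfl, fun _ => rfl⟩
  legR := ⟨fun _ => ⟨⟩, fun _ => ⟨⟩, fun _ => rfl, fun _ => rfl, fun _ => rfl⟩
  cell t := evCell hC (U.sit.onE t)
  wf_cell _ := (isDual hC _).wf_counit
  top_cell _ := (isDual hC _).top_counit
  bot_cell _ := (isDual hC _).bot_counit
  left_cell _ := (isDual hC _).left_counit
  right_cell _ := (isDual hC _).right_counit
  cell_triv a := (congrArg (evCell hC) (U.sit.onE_triv a)).trans (dual_nil hC).2.2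

open SituatedSystem

/-- The unit and counit systems satisfy the first snake equation: the diagonals match up the three
copies of the graph, and the cells compose by the snake equation for exchanges. -/
theorem coev_ev : (coev hC U).hom ▷ U ≫ (α_ U (U.dual hC) U).hom ≫ U ◁ (ev hC U).hom =
    (λ_ U).hom ≫ (ρ_ U).inv := by
  have e : (λ_ U).hom ≫ (ρ_ U).inv =
      (ofMap ((LabelledHom.ofHom (lunitHom U) (lunitHom_sit U)).comp
        (LabelledHom.ofHom (runitInv U) (runitInv_sit U)))).hom :=
    LabelledHom.hom_comp (LabelledHom.ofHom (lunitHom U) (lunitHom_sit U))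
      (LabelledHom.ofHom (runitInv U) (runitInv_sit U))
  rw [e, ← Category.assoc, ← id_tensorHom, ← tensorHom_id, ← LabelledHom.hom_id,
    LabelledHom.associator_hom]
  simp only [LabelledHom.hom]
  rw [hom_tensor_hom, hom_tensor_hom, hom_comp_ofMap]
  refine hom_comp_hom ⟨fun a => (a.2, a.2), fun t => (t.2, t.2), fun _ => rfl, fun _ => rfl,
    fun _ => rfl⟩ ⟨fun a => (a.2, a.2), fun t => (t.2, t.2), fun _ => rfl, fun _ => rfl,
    fun _ => rfl⟩ rfl rfl rfl ?_ ?_ ?_ ?_ ?_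
  · exact fun a b h _ => Prod.ext rfl (congrArg Prod.fst h)
  · exact fun a b h _ => Prod.ext rfl (congrArg Prod.fst h)
  · rintro ⟨a, b⟩ ⟨c, d⟩ h
    obtain ⟨h₁ : a = c, h'⟩ := Prod.ext_iff.1 h
    obtain ⟨h₂ : a = d, h₃ : b = d⟩ := Prod.ext_iff.1 h'
    subst h₁ h₂ h₃
    exact ⟨(⟨⟩, _), rfl, rfl⟩
  · rintro ⟨a, b⟩ ⟨c, d⟩ h
    obtain ⟨h₁ : a = c, h'⟩ := Prod.ext_iff.1 h
    obtain ⟨h₂ : a = d, h₃ : b = d⟩ := Prod.ext_iff.1 h'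
    subst h₁ h₂ h₃
    exact ⟨(⟨⟩, _), rfl, rfl⟩
  · rintro ⟨⟨⟩, t⟩
    have h := isDual hC (U.sit.onE t)
    refine (h_hid (hid (U.sit.onE t)) rfl).trans ?_
    refine h.snake_left.symm.trans (congrArg (fun x => x ∣ₕ _) (h_hid _ ?_).symm)
    exact (right_tensor _ _).trans (congrArg (· ++ _) h.right_unit)

/-- The second snake equation, as `coev_ev`. -/
theorem ev_coev : U.dual hC ◁ (coev hC U).hom ≫ (α_ (U.dual hC) U (U.dual hC)).inv ≫
    (ev hC U).hom ▷ U.dual hC = (ρ_ (U.dual hC)).hom ≫ (λ_ (U.dual hC)).inv := by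
  have e : (ρ_ (U.dual hC)).hom ≫ (λ_ (U.dual hC)).inv =
      (ofMap ((LabelledHom.ofHom (runitHom (U.dual hC)) (runitHom_sit _)).comp
        (LabelledHom.ofHom (lunitInv (U.dual hC)) (lunitInv_sit _)))).hom :=
    LabelledHom.hom_comp (LabelledHom.ofHom (runitHom (U.dual hC)) (runitHom_sit _))
      (LabelledHom.ofHom (lunitInv (U.dual hC)) (lunitInv_sit _))
  rw [e, ← Category.assoc, ← id_tensorHom, ← tensorHom_id, ← LabelledHom.hom_id,
    LabelledHom.associator_inv]
  simp only [LabelledHom.hom]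
  rw [hom_tensor_hom, hom_tensor_hom, hom_comp_ofMap]
  refine hom_comp_hom ⟨fun a => (a.1, a.1), fun t => (t.1, t.1), fun _ => rfl, fun _ => rfl,
    fun _ => rfl⟩ ⟨fun a => (a.1, a.1), fun t => (t.1, t.1), fun _ => rfl, fun _ => rfl,
    fun _ => rfl⟩ rfl rfl rfl ?_ ?_ ?_ ?_ ?_
  · exact fun a b h _ => Prod.ext (Prod.ext_iff.1 h).1 rfl
  · exact fun a b h _ => Prod.ext (Prod.ext_iff.1 h).1 rfl
  · rintro ⟨a, b⟩ ⟨c, d⟩ h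
    obtain ⟨h', h₂ : b = d⟩ := Prod.ext_iff.1 h
    obtain ⟨h₁ : a = c, h₃ : b = c⟩ := Prod.ext_iff.1 h'
    subst h₁ h₂ h₃
    exact ⟨(_, ⟨⟩), rfl, rfl⟩
  · rintro ⟨a, b⟩ ⟨c, d⟩ h
    obtain ⟨h', h₂ : b = d⟩ := Prod.ext_iff.1 h
    obtain ⟨h₁ : a = c, h₃ : b = c⟩ := Prod.ext_iff.1 h'
    subst h₁ h₂ h₃
    exact ⟨(_, ⟨⟩), rfl, rfl⟩
  · rintro ⟨t, ⟨⟩⟩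
    have h := isDual hC (U.sit.onE t)
    have hr : ((LabelledHom.ofHom (runitHom (U.dual hC)) (runitHom_sit _)).comp
        (LabelledHom.ofHom (lunitInv (U.dual hC)) (lunitInv_sit _))).cell (t, ⟨⟩) =
        hid (dualExchange hC (U.sit.onE t)) := by
      refine (LabelledHom.cell_comp_ofHom _ _ _ _).trans ?_
      exact congrArg hid (List.append_nil _)
    refine hr.trans ?_
    refine h.snake_right.symm.trans (congrArg (fun x => x ∣ₕ _) (h_hid _ ?_).symm)
    exact (right_tensor _ _).trans (congrArg (_ ++ ·) h.right_unit)

end StatelessSystem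

end dual

end Situated

/-- If a resource theory `A` (a symmetric strict monoidal category) is compact closed, that is, if
every object of `A` has a dual, then so is the monoidal category of `A`-situated transition
systems: it has a symmetry, and every object has a dual. -/
theorem lemma4p3 (A : Type u) [Category.{v} A] [MonoidalCategory A] [Situated.StrictMonoidal A]
    [SymmetricCategory A] (hA : Situated.HasDuals A) :
    ∃ _ : SymmetricCategory (Situated.SituatedBoundary.{p, q} A),
      Situated.HasDuals (Situated.SituatedBoundary.{p, q} A) :=
  ⟨Situated.symmetricCategory hA, fun U => ⟨U.dual hA,
    ⟨{ coevaluation' := (Situated.StatelessSystem.coev hA U).hom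
       evaluation' := (Situated.StatelessSystem.ev hA U).hom
       coevaluation_evaluation' := Situated.StatelessSystem.ev_coev hA U
       evaluation_coevaluation' := Situated.StatelessSystem.coev_ev hA U }⟩⟩⟩
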